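/- Let $G$ be a connected (finite-dimensional, real) Lie group with Lie algebra $\mathfrak g$, $K$ a closed subgroup with Lie algebra $\mathfrak k$, and $N=G/K$ the coset manifold, with projection $\pi:G\to N$, $\pi(a)=aK$. Suppose $N$ is reductive, i.e. fix a subspace $\mathfrak p\subset\mathfrak g$ with $\mathfrak g=\mathfrak k\oplus\mathfrak p$ and $\mathrm{Ad}(K)\mathfrak p\subset\mathfrak p$; write $X_{\mathfrak k}, X_{\mathfrak p}$ for the components of $X\in\mathfrak g$, and $l_a$ for the left translation of $G$ by $a$. *Connections.* For a reductive homogeneous space $L/Q$ with decomposition $\mathfrak l=\mathfrak q\oplus\mathfrak m$, base point $o=eQ$ and projection $\mathrm{pr}:L\to L/Q$, and for $Y\in\mathfrak m$, let $Y^\#$ be the smooth vector field near $o$ given by $Y^\#_{aQ}=d\,\mathrm{pr}(Y_a)$ for $a=\exp W$, $W\in\mathfrak m$ close to $0$, where $Y_a$ is the value at $a$ of the left invariant vector field $Y$. An $L$-invariant affine connection $\nabla$ on $L/Q$ has connection function $\alpha:\mathfrak m\times\mathfrak m\to\mathfrak m$ if $\nabla_{X^\#_o}Y^\#=\alpha(X,Y)$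 for all $X,Y\in\mathfrak m\cong T_o(L/Q)$. The canonical connection is the invariant connection with $\alpha=0$; the natural torsion-free connection is the invariant connection with $\alpha(X,Y)=\tfrac12[X,Y]_{\mathfrak m}$. Let $\nabla^N$ be the natural torsion-free connection of $N=G/K$, and let $\nabla^G$ be the canonical connection of $G\cong(G\times G)/\Delta G$, where $G\times G$ acts on $G$ by $(b,c)\cdot a=bac^{-1}$ with base point $e$, and $\mathfrak g\oplus\mathfrak g=\Delta\mathfrak g\oplus\{(X,-X)\mid X\in\mathfrak g\}$. *Affine submersions.* Let $f:(M,\nabla^M)\to(M',\nabla^{M'})$ be a smooth submersion between manifolds with affine connections, and $\mathcal H$ a smooth distribution on $M$ with $TM=\mathcal H\oplus\mathcal V$, $\mathcal V=\ker df$; superscripts $\mathcal H,\mathcal V$ denote components and a bar denotes the horizontal lift. Then $f$ is an affine submersion with horizontal distribution $\mathcal H$ if $(\nabla^M_{\bar X}\bar Z)^{\mathcal H}=\overline{\nabla^{M'}_XZ}$ for all smooth vector fields $X,Z$ on $M'$. Its fundamental tensor $\mathcal A$ is the tensor field with $\mathcal A(X,Y)=(\nabla^M_{X^{\mathcal H}}Y^{\mathcal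 H})^{\mathcal V}+(\nabla^M_{X^{\mathcal H}}Y^{\mathcal V})^{\mathcal H}$ for smooth vector fields $X,Y$ on $M$. *Claim.* The projection $\pi:(G,\nabla^G)\to(N,\nabla^N)$ is an affine submersion with horizontal distribution $\mathcal H^\pi(a)=dl_a(\mathfrak p)$, $a\in G$. Its fundamental tensor $\mathcal A^\pi$ satisfies $$\mathcal A^\pi(dl_aX,dl_aY)=dl_a\bigl(\tfrac12[X,Y]_{\mathfrak k}\bigr)\qquad(a\in G,\ X,Y\in\mathfrak p),$$ and in particular $\mathcal A^\pi$ restricted to $\mathcal H^\pi\times\mathcal H^\pi$ is alternating. -/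

import Mathlib

open scoped Manifold ContDiff Topology
open Bundle VectorField

noncomputable section

namespace AffineSubmersion

/-! ### Vector fields, Lie groups and their Lie algebras -/

section Manifold

variable {E : Type*} [NormedAddCommGroup E] [NormedSpace ℝ E]
  {H : Type*} [TopologicalSpace H] (I : ModelWithCorners ℝ E H)
  {M : Type*} [TopologicalSpace M] [ChartedSpace H M]

/-- The vector field `Z` is smooth on the set `U`. -/
def SmoothFieldOn [IsManifold I 1 M] (Z : Π x : M, TangentSpace I x) (U : Set M) : Prop :=
  ContMDiffOn I I.tangent ∞ (fun x ↦ (⟨x, Z x⟩ : TangentBundle I M)) U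

/-- The vector field `Z` is smooth, i.e. `Z ∈ 𝔛(M)`. -/
def SmoothField [IsManifold I 1 M] (Z : Π x : M, TangentSpace I x) : Prop :=
  ContMDiff I I.tangent ∞ (fun x ↦ (⟨x, Z x⟩ : TangentBundle I M))

end Manifold

section LieGroup

variable {E : Type*} [NormedAddCommGroup E] [NormedSpace ℝ E]
  {H : Type*} [TopologicalSpace H] (I : ModelWithCorners ℝ E H)
  {G : Type*} [TopologicalSpace G] [ChartedSpace H G] [Group G]

/-- The curve `γ` passes through the identity at time `0` with velocity `X`. -/
def HasVelocityAtOne (γ : ℝ → G) (X : GroupLieAlgebra I G) : Prop :=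
  γ 0 = 1 ∧ HasMFDerivAt 𝓘(ℝ) I γ 0 (ContinuousLinearMap.toSpanSingleton ℝ (X : E))

/-- `g = exp X`: `g` is the time-one value of the one-parameter subgroup with velocity `X`. -/
def IsExp (X : GroupLieAlgebra I G) (g : G) : Prop :=
  ∃ γ : ℝ → G, ContMDiff 𝓘(ℝ) I ∞ γ ∧ (∀ s t, γ (s + t) = γ s * γ t) ∧
    HasVelocityAtOne I γ X ∧ γ 1 = g

/-- The adjoint representation `Ad k = d(g ↦ k g k⁻¹)_e`. -/
def Ad (k : G) : GroupLieAlgebra I G →L[ℝ] GroupLieAlgebra I G :=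
  mfderiv I I (fun g : G ↦ k * g * k⁻¹) 1

/-- The Lie algebra `𝔨 = T_e K` of a closed subgroup `K`: the velocities at the identity of smooth
curves of `G` that stay in `K`. -/
def subgroupLieAlgebra [LieGroup I ∞ G] (K : Subgroup G) :
    Submodule ℝ (GroupLieAlgebra I G) where
  carrier := {X | ∃ γ : ℝ → G, ContMDiff 𝓘(ℝ) I ∞ γ ∧ (∀ t, γ t ∈ K) ∧ HasVelocityAtOne I γ X}
  zero_mem' := by
    refine ⟨fun _ ↦ 1, contMDiff_const, fun _ ↦ K.one_mem, rfl, ?_⟩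
    have h : (ContinuousLinearMap.toSpanSingleton ℝ (0 : E)) = 0 := by ext; simp
    exact h ▸ hasMFDerivAt_const (I := 𝓘(ℝ)) (I' := I) (1 : G) (0 : ℝ)
  add_mem' := by
    rintro X Y ⟨γ, hγ, hγK, hγ0, hγX⟩ ⟨δ, hδ, hδK, hδ0, hδY⟩
    refine ⟨fun t ↦ γ t * δ t, hγ.mul hδ, fun t ↦ K.mul_mem (hγK t) (hδK t), by simp [hγ0, hδ0], ?_⟩
    have hm : HasMFDerivAt (I.prod I) I (fun p : G × G ↦ p.1 * p.2) (γ 0, δ 0)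
        ((ContinuousLinearMap.fst ℝ E E) + (ContinuousLinearMap.snd ℝ E E)) := by
      rw [hγ0, hδ0]
      have hd : MDifferentiableAt (I.prod I) I (fun p : G × G ↦ p.1 * p.2) (1, 1) :=
        (contMDiff_mul I ∞).mdifferentiableAt (by simp)
      have h := hd.hasMFDerivAt
      rw [mfderiv_prod_eq_add hd] at h
      have h1 : mfderiv (I.prod I) I (fun z : G × G ↦ z.1 * 1) ((1 : G), (1 : G)) =
          ContinuousLinearMap.fst ℝ E E := by
        exact ((hasMFDerivAt_fst (I := I) (I' := I) ((1 : G), (1 : G))).congr_of_eventuallyEq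
          (.of_forall fun z ↦ mul_one z.1)).mfderiv
      have h2 : mfderiv (I.prod I) I (fun z : G × G ↦ 1 * z.2) ((1 : G), (1 : G)) =
          ContinuousLinearMap.snd ℝ E E := by
        exact ((hasMFDerivAt_snd (I := I) (I' := I) ((1 : G), (1 : G))).congr_of_eventuallyEq
          (.of_forall fun z ↦ one_mul z.2)).mfderiv
      exact h1 ▸ h2 ▸ h
    have h := hm.comp (0 : ℝ) (hγX.prodMk hδY)
    have e : ((ContinuousLinearMap.fst ℝ E E) + (ContinuousLinearMap.snd ℝ E E)).comp
        ((ContinuousLinearMap.toSpanSingleton ℝ (X : E)).prod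
          (ContinuousLinearMap.toSpanSingleton ℝ (Y : E))) =
        ContinuousLinearMap.toSpanSingleton ℝ ((X : E) + (Y : E)) := by
      refine ContinuousLinearMap.ext fun t ↦ ?_
      exact (smul_add t (X : E) (Y : E)).symm
    exact e ▸ h
  smul_mem' := by
    rintro c X ⟨γ, hγ, hγK, hγ0, hγX⟩
    refine ⟨fun t ↦ γ (c * t), hγ.comp (contMDiff_const.mul contMDiff_id),
      fun t ↦ hγK _, by simp [hγ0], ?_⟩
    have hc : HasMFDerivAt 𝓘(ℝ) 𝓘(ℝ) (fun t : ℝ ↦ c * t) 0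
        (ContinuousLinearMap.toSpanSingleton ℝ c) := by
      have := ((hasDerivAt_id (0 : ℝ)).const_mul c).hasFDerivAt.hasMFDerivAt
      simpa using! this
    have hγ' : HasMFDerivAt 𝓘(ℝ) I γ (c * 0) (ContinuousLinearMap.toSpanSingleton ℝ (X : E)) := by
      rw [mul_zero]
      exact hγX
    have h := hγ'.comp (0 : ℝ) hc
    have e : (ContinuousLinearMap.toSpanSingleton ℝ (X : E)).comp
        (ContinuousLinearMap.toSpanSingleton ℝ c) =
        ContinuousLinearMap.toSpanSingleton ℝ (c • (X : E)) := by
      ext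
      simp
    exact e ▸ h

end LieGroup

/-! ### Invariant connections on homogeneous spaces

A homogeneous space is given here by a Lie group `L`, a manifold `M`, an action
`act : L → M → M` and a base point `o : M`; the projection `L → M` is the orbit map
`g ↦ act g o`. For `M = G ⧸ K` with `o = eK` the orbit map is `a ↦ aK`. For `M = G` with the action
`(b, c) · a = b a c⁻¹` of `G × G` and `o = e` this is `G ≅ (G × G) / ΔG`. -/

section Homogeneous

variable {E : Type*} [NormedAddCommGroup E] [NormedSpace ℝ E]
  {H : Type*} [TopologicalSpace H] (I : ModelWithCorners ℝ E H)
  {L : Type*} [TopologicalSpace L] [ChartedSpace H L] [Group L]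
  {E' : Type*} [NormedAddCommGroup E'] [NormedSpace ℝ E']
  {H' : Type*} [TopologicalSpace H'] (J : ModelWithCorners ℝ E' H')
  {M : Type*} [TopologicalSpace M] [ChartedSpace H' M]
  (act : L → M → M) (o : M)

/-- The differential at the identity of the projection `g ↦ act g o`, which identifies the
complement `𝔭` of the isotropy algebra with `T_o M` (recall that `act 1 o = o`). -/
def dproj : GroupLieAlgebra I L →L[ℝ] TangentSpace J o :=
  mfderiv I J (fun g : L ↦ act g o) 1

/-- The vector field `V` is a smooth representative near `o` of the local vector field `Y^#`,
defined by `Y^#_{a · o} = dπ(Y_a)` for all `a = exp W` with `W ∈ 𝔭` close to `0`, where `Y_a` is the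
value at `a` of the left invariant vector field `Y`. These conditions determine `V` near `o`. -/
def IsSharpField [IsManifold J 1 M] (𝔭 : Submodule ℝ (GroupLieAlgebra I L))
    (Y : GroupLieAlgebra I L) (V : Π x : M, TangentSpace J x) : Prop :=
  (∃ U ∈ 𝓝 o, SmoothFieldOn J V U) ∧
  ∀ᶠ W in 𝓝 (0 : GroupLieAlgebra I L), W ∈ 𝔭 → ∀ a : L, IsExp I W a →
    V (act a o) = mfderiv I J (fun g : L ↦ act g o) a (mulInvariantVectorField Y a)

/-- An `L`-invariant (smooth) affine connection:
`∇_{dL_a v} (dL_a Z) = dL_a (∇_v Z)`, written for the field `dL_a Z = Z'`, so that `Z` is the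
pullback of `Z'` by the translation by `a`. -/
structure IsInvariantConnection [IsManifold J 1 M]
    (cov : CovariantDerivative J E' (TangentSpace J : M → Type _)) : Prop where
  smooth : CovariantDerivative.ContMDiffCovariantDerivative cov ∞
  invariant : ∀ (a : L) (Z' : Π x : M, TangentSpace J x), SmoothField J Z' →
    ∀ (x : M) (v : TangentSpace J x),
      cov Z' (act a x) (mfderiv J J (act a) x v) =
        mfderiv J J (act a) x (cov (mpullback J J (act a) Z') x v)

/-- `cov` is the invariant connection with connection function `α`:
`∇_{X^#_o} Y^# = α(X, Y)` for `X, Y ∈ 𝔭`, where `𝔭` is identified with `T_o M`. -/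
structure IsInvariantConnectionWith [IsManifold J 1 M] (𝔭 : Submodule ℝ (GroupLieAlgebra I L))
    (α : 𝔭 → 𝔭 → 𝔭) (cov : CovariantDerivative J E' (TangentSpace J : M → Type _)) : Prop
    extends IsInvariantConnection J act cov where
  connection_function : ∀ Y : 𝔭, ∃ V : Π x : M, TangentSpace J x,
    IsSharpField I J act o 𝔭 (Y : GroupLieAlgebra I L) V ∧
    ∀ X : 𝔭, cov V o (dproj I J act o X) = dproj I J act o (α X Y)

end Homogeneous

/-! ### The coset manifold and the two connections -/

section Coset

variable {E : Type*} [NormedAddCommGroup E] [NormedSpace ℝ E]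
  {H : Type*} [TopologicalSpace H] (I : ModelWithCorners ℝ E H)
  {G : Type*} [TopologicalSpace G] [ChartedSpace H G] [Group G]
  {E' : Type*} [NormedAddCommGroup E'] [NormedSpace ℝ E']
  {H' : Type*} [TopologicalSpace H'] (J : ModelWithCorners ℝ E' H')

/-- The smooth structure on `G ⧸ K` is that of the coset manifold: the (unique) one for which the
projection is smooth and has smooth local sections around every point. -/
structure IsCosetManifold (K : Subgroup G) [ChartedSpace H' (G ⧸ K)] : Prop where
  contMDiff_mk : ContMDiff I J ∞ (fun a : G ↦ (a : G ⧸ K))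
  exists_section : ∀ x : G ⧸ K, ∃ U ∈ 𝓝 x, ∃ s : G ⧸ K → G,
    ContMDiffOn J I ∞ s U ∧ ∀ y ∈ U, (s y : G ⧸ K) = y

/-- `𝔤 = 𝔨 ⊕ 𝔭` with `𝔭` invariant under `Ad(K)`. -/
structure IsReductive [LieGroup I ∞ G] (K : Subgroup G) (𝔭 : Submodule ℝ (GroupLieAlgebra I G)) :
    Prop where
  isCompl : IsCompl (subgroupLieAlgebra I K) 𝔭
  ad_mem : ∀ k ∈ K, ∀ X ∈ 𝔭, Ad I k X ∈ 𝔭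

variable {I} in
/-- The component `X_𝔨`. -/
def IsReductive.kPart [LieGroup I ∞ G] {K : Subgroup G} {𝔭 : Submodule ℝ (GroupLieAlgebra I G)}
    (h : IsReductive I K 𝔭) : GroupLieAlgebra I G →ₗ[ℝ] subgroupLieAlgebra I K :=
  Submodule.projectionOnto _ _ h.isCompl

variable {I} in
/-- The component `X_𝔭`. -/
def IsReductive.pPart [LieGroup I ∞ G] {K : Subgroup G} {𝔭 : Submodule ℝ (GroupLieAlgebra I G)}
    (h : IsReductive I K 𝔭) : GroupLieAlgebra I G →ₗ[ℝ] 𝔭 :=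
  Submodule.projectionOnto _ _ h.isCompl.symm

variable {I} in
/-- The natural torsion-free connection of the reductive homogeneous space `G ⧸ K`: the invariant
connection with connection function `α(X, Y) = ½ [X, Y]_𝔭`. -/
def IsNaturalTorsionFree [LieGroup I ∞ G] {K : Subgroup G}
    {𝔭 : Submodule ℝ (GroupLieAlgebra I G)} (h : IsReductive I K 𝔭)
    [ChartedSpace H' (G ⧸ K)] [IsManifold J 1 (G ⧸ K)]
    (cov : CovariantDerivative J E' (TangentSpace J : G ⧸ K → Type _)) : Prop :=
  IsInvariantConnectionWith I J (fun (a : G) (x : G ⧸ K) ↦ a • x) ((1 : G) : G ⧸ K) 𝔭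
    (fun X Y ↦ (1 / 2 : ℝ) • h.pPart ⁅(X : GroupLieAlgebra I G), (Y : GroupLieAlgebra I G)⁆) cov

/-- The subspace `{(X, -X) | X ∈ 𝔤}` of `𝔤 ⊕ 𝔤`, the Lie algebra of `G × G`. -/
def antidiagonal : Submodule ℝ (GroupLieAlgebra (I.prod I) (G × G)) :=
  LinearMap.range
    ((LinearMap.id.prod (-LinearMap.id) : E →ₗ[ℝ] E × E) :
      GroupLieAlgebra I G →ₗ[ℝ] GroupLieAlgebra (I.prod I) (G × G))

/-- The canonical connection of `G ≅ (G × G) / ΔG` (via `(a, b) ↦ a b⁻¹`): the connection invariant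
under the action `(b, c) · a = b a c⁻¹` with connection function `0` on `{(X, -X)}`. -/
def IsCanonicalConnection [LieGroup I ∞ G]
    (cov : CovariantDerivative I E (TangentSpace I : G → Type _)) : Prop :=
  IsInvariantConnectionWith (I.prod I) I (fun (p : G × G) (a : G) ↦ p.1 * a * p.2⁻¹) (1 : G)
    (antidiagonal I) (fun _ _ ↦ 0) cov

/-- The distribution `a ↦ dl_a(𝔭)` on `G`. -/
def leftDistribution (𝔭 : Submodule ℝ (GroupLieAlgebra I G)) (a : G) :
    Submodule ℝ (TangentSpace I a) :=
  𝔭.map (mfderiv I I (fun g : G ↦ a * g) 1 :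
    GroupLieAlgebra I G →L[ℝ] TangentSpace I a).toLinearMap

end Coset

/-! ### Affine submersions with horizontal distribution -/

section Submersion

variable {E : Type*} [NormedAddCommGroup E] [NormedSpace ℝ E]
  {H : Type*} [TopologicalSpace H] (I : ModelWithCorners ℝ E H)
  {M : Type*} [TopologicalSpace M] [ChartedSpace H M]
  {E' : Type*} [NormedAddCommGroup E'] [NormedSpace ℝ E']
  {H' : Type*} [TopologicalSpace H'] (J : ModelWithCorners ℝ E' H')
  {N : Type*} [TopologicalSpace N] [ChartedSpace H' N]
  (f : M → N) (𝓗 : Π a : M, Submodule ℝ (TangentSpace I a))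

/-- The vertical space `ker (df)_a`. -/
def vertical (a : M) : Submodule ℝ (TangentSpace I a) :=
  LinearMap.ker (mfderiv I J f a).toLinearMap

/-- `𝓗` has smooth local frames. -/
def IsSmoothDistribution [IsManifold I 1 M] : Prop :=
  ∀ a : M, ∃ U ∈ 𝓝 a, ∃ (n : ℕ) (F : Fin n → Π b : M, TangentSpace I b),
    (∀ i, SmoothFieldOn I (F i) U) ∧
    ∀ b ∈ U, LinearIndependent ℝ (fun i ↦ F i b) ∧
      Submodule.span ℝ (Set.range fun i ↦ F i b) = 𝓗 b

/-- `Zbar` is the horizontal lift of the vector field `Z`. -/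
def IsHorizontalLift (Z : Π x : N, TangentSpace J x) (Zbar : Π a : M, TangentSpace I a) : Prop :=
  ∀ a, Zbar a ∈ 𝓗 a ∧ mfderiv I J f a (Zbar a) = Z (f a)

section Projections

variable {I J f 𝓗} (hc : ∀ a, IsCompl (𝓗 a) (vertical I J f a))

/-- The horizontal component of a vector field. -/
def hor (Z : Π a : M, TangentSpace I a) (a : M) : TangentSpace I a :=
  Submodule.projectionOnto _ _ (hc a) (Z a)

/-- The vertical component of a vector field. -/
def ver (Z : Π a : M, TangentSpace I a) (a : M) : TangentSpace I a :=
  Submodule.projectionOnto _ _ (hc a).symm (Z a)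

/-- `A` is the fundamental tensor of the submersion: the tensor field with
`A_X Y = (∇_{X^𝓗} Y^𝓗)^𝓥 + (∇_{X^𝓗} Y^𝓥)^𝓗` for all smooth vector fields `X`, `Y`. -/
def IsFundamentalTensor [IsManifold I 1 M]
    (cov : CovariantDerivative I E (TangentSpace I : M → Type _))
    (A : Π a : M, TangentSpace I a →ₗ[ℝ] TangentSpace I a →ₗ[ℝ] TangentSpace I a) : Prop :=
  ∀ X Y : Π a : M, TangentSpace I a, SmoothField I X → SmoothField I Y → ∀ a,
    A a (X a) (Y a) =
      ver hc (fun b ↦ cov (hor hc Y) b (hor hc X b)) a +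
      hor hc (fun b ↦ cov (ver hc Y) b (hor hc X b)) a

end Projections

/-- `f : (M, ∇^M) → (N, ∇^N)` is an affine submersion with horizontal distribution `𝓗`: a smooth
submersion, together with a smooth distribution `𝓗` complementary to the vertical one, such that
the horizontal component of `∇^M_{Xbar} Zbar` is the horizontal lift of `∇^N_X Z`. -/
structure IsAffineSubmersion [IsManifold I 1 M] [IsManifold J 1 N]
    (covM : CovariantDerivative I E (TangentSpace I : M → Type _))
    (covN : CovariantDerivative J E' (TangentSpace J : N → Type _)) : Prop where
  contMDiff : ContMDiff I J ∞ f
  surjective : ∀ a, Function.Surjective (mfderiv I J f a)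
  smooth : IsSmoothDistribution I 𝓗
  isCompl : ∀ a, IsCompl (𝓗 a) (vertical I J f a)
  affine : ∀ (X Z : Π x : N, TangentSpace J x) (Xbar Zbar : Π a : M, TangentSpace I a),
    SmoothField J X → SmoothField J Z →
    IsHorizontalLift I J f 𝓗 X Xbar → IsHorizontalLift I J f 𝓗 Z Zbar →
    IsHorizontalLift I J f 𝓗 (fun x ↦ covN Z x (X x))
      (hor isCompl (fun a ↦ covM Zbar a (Xbar a)))

end Submersion

end AffineSubmersion

end

open AffineSubmersion

noncomputable section

namespace AffineSubmersion

/-! Both connections become the same formula once fields are expanded in left invariant frames. The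
key fact is that the canonical connection satisfies `∇_X Y = ½ [X, Y]` on left invariant fields
(`IsCanonicalConnection.cov_mulInvariantVectorField`). So for a field `∑ ζ i • b i` on `G`, with
left invariant `b i`, its derivative along a left invariant `X` is `∑ (X ζ i) • b i + ½ [X, ∑ ζ i •
b i]`.

If the `b i` form a basis of `𝔭`, the first sum stays in `𝔭`, and the horizontal part of the whole
is `∑ (X ζ i) • b i + ½ [X, ∑ ζ i • b i]_𝔭`. On `N`, the field `Y^#` agrees along `exp(tX) · o` with
the projection of the left invariant field `Y`, and a covariant derivative depends only on values
along a curve. Hence the connection function `½ [X, Y]_𝔭` gives exactly the projection of that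
expression at the base point, and invariance carries it everywhere (`IsNaturalTorsionFree.cov_base`,
`IsNaturalTorsionFree.cov_mk`). This is the affine submersion property.

For the fundamental tensor, the derivative terms lie in `𝔭` or in `𝔨` and are killed by the opposite
projection. What survives is the tensorial expression `½ [X_𝔭, Y_𝔭]_𝔨 + ½ [X_𝔭, Y_𝔨]_𝔭`, which is `½
[X, Y]_𝔨` on `𝔭` and vanishes for `X = Y`.

The key fact at the identity is a second-order computation in a chart. With `γ`, `η` the
one-parameter subgroups of `X`, `Y`, the mixed second derivatives of `γ r * η s * γ t` give the
derivatives of the left invariant `Y` along `γ`, of the left invariant `X` along `η`, and of the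
field `(Y, -Y)^#`; the vanishing connection function then determines the Christoffel term. -/

theorem lieGroup_minSmoothness {E : Type*} [NormedAddCommGroup E] [NormedSpace ℝ E]
    {H : Type*} [TopologicalSpace H] {I : ModelWithCorners ℝ E H}
    {G : Type*} [TopologicalSpace G] [ChartedSpace H G] [Group G] [LieGroup I ∞ G] :
    LieGroup I (minSmoothness ℝ 3) G := by
  rw [minSmoothness_of_isRCLikeNormedField]
  exact LieGroup.of_le (n := ∞) (WithTop.coe_le_coe.2 (le_top : (3 : ℕ∞) ≤ ⊤))

/-! ### Velocities of curves -/

section Velocity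
variable {E : Type*} [NormedAddCommGroup E] [NormedSpace ℝ E]
  {H : Type*} [TopologicalSpace H] {I : ModelWithCorners ℝ E H}
  {M : Type*} [TopologicalSpace M] [ChartedSpace H M]
  {E' : Type*} [NormedAddCommGroup E'] [NormedSpace ℝ E']
  {H' : Type*} [TopologicalSpace H'] {J : ModelWithCorners ℝ E' H'}
  {N : Type*} [TopologicalSpace N] [ChartedSpace H' N]

variable (I) in
/-- The curve `γ` passes through `x` at time `t` with velocity `v`. -/
def HasVelocityAt (γ : ℝ → M) (t : ℝ) (x : M) (v : TangentSpace I x) : Prop :=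
  γ t = x ∧ HasMFDerivAt 𝓘(ℝ) I γ t (ContinuousLinearMap.toSpanSingleton ℝ (v : E))

theorem HasVelocityAt.comp {γ : ℝ → M} {t : ℝ} {x : M} {v : TangentSpace I x}
    (h : HasVelocityAt I γ t x v) {f : M → N} (hf : MDifferentiableAt I J f x) :
    HasVelocityAt J (fun s ↦ f (γ s)) t (f x) (mfderiv I J f x v) := by
  obtain ⟨rfl, h⟩ := h
  refine ⟨rfl, ?_⟩
  have e (L : E →L[ℝ] E') (v : E) : L.comp (ContinuousLinearMap.toSpanSingleton ℝ v) =
      ContinuousLinearMap.toSpanSingleton ℝ (L v) := by ext; simp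
  exact (e (mfderiv I J f (γ t)) v) ▸ hf.hasMFDerivAt.comp t h

theorem HasVelocityAt.unique {γ : ℝ → M} {t : ℝ} {x : M} {v w : TangentSpace I x}
    (h : HasVelocityAt I γ t x v) (h' : HasVelocityAt I γ t x w) : v = w := by
  obtain ⟨rfl, h⟩ := h
  have e (v w : E) (h : ContinuousLinearMap.toSpanSingleton ℝ v =
      ContinuousLinearMap.toSpanSingleton ℝ w) : v = w := by
    simpa using DFunLike.congr_fun h (1 : ℝ)
  exact e _ _ (hasMFDerivAt_unique h h'.2)

theorem HasVelocityAt.hasDerivAt {γ : ℝ → E} {t : ℝ} {x v : E}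
    (h : HasVelocityAt 𝓘(ℝ, E) γ t x v) : HasDerivAt γ v t :=
  hasDerivAt_iff_hasFDerivAt.2 h.2.hasFDerivAt

theorem HasVelocityAt.comp_real {γ : ℝ → M} {t : ℝ} {x : M} {v : TangentSpace I x} {φ : ℝ → ℝ}
    {s c : ℝ} (h : HasVelocityAt I γ t x v) (hφ : HasDerivAt φ c s) (hs : φ s = t) :
    HasVelocityAt I (fun r ↦ γ (φ r)) s x (c • v) := by
  subst hs
  have e (v : E) : (ContinuousLinearMap.toSpanSingleton ℝ v).comp
      (ContinuousLinearMap.toSpanSingleton ℝ c) =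
        ContinuousLinearMap.toSpanSingleton ℝ (c • v) := by ext; simp
  exact ⟨h.1, (e (v : E)) ▸ h.2.comp s (hasDerivAt_iff_hasFDerivAt.1 hφ).hasMFDerivAt⟩

theorem hasVelocityAt_const (x : M) (t : ℝ) : HasVelocityAt I (fun _ : ℝ ↦ x) t x 0 := by
  have h : (ContinuousLinearMap.toSpanSingleton ℝ (0 : E)) = 0 := by ext; simp
  exact ⟨rfl, h ▸ hasMFDerivAt_const (I := 𝓘(ℝ)) (I' := I) x t⟩

theorem HasVelocityAt.prodMk {γ : ℝ → M} {δ : ℝ → N} {t : ℝ} {x : M} {y : N}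
    {v : TangentSpace I x} {w : TangentSpace J y}
    (h : HasVelocityAt I γ t x v) (h' : HasVelocityAt J δ t y w) :
    HasVelocityAt (I.prod J) (fun s ↦ (γ s, δ s)) t (x, y) ((v, w) : E × E') := by
  refine ⟨Prod.ext h.1 h'.1, ?_⟩
  have e (v : E) (w : E') : (ContinuousLinearMap.toSpanSingleton ℝ v).prod
      (ContinuousLinearMap.toSpanSingleton ℝ w) =
        ContinuousLinearMap.toSpanSingleton ℝ (v, w) := by ext <;> simp
  exact (e (v : E) (w : E')) ▸ h.2.prodMk h'.2

theorem HasVelocityAt.hasDerivAt_comp {γ : ℝ → M} {t : ℝ} {x : M} {v : TangentSpace I x}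
    (h : HasVelocityAt I γ t x v) {F : Type*} [NormedAddCommGroup F] [NormedSpace ℝ F]
    {f : M → F} (hf : MDifferentiableAt I 𝓘(ℝ, F) f x) :
    HasDerivAt (fun s ↦ f (γ s)) (mvfderiv I f x v) t :=
  (h.comp hf).hasDerivAt

end Velocity

/-! ### Covariant derivatives in a chart and along curves -/

section Coord
variable {E : Type*} [NormedAddCommGroup E] [NormedSpace ℝ E]
  {H : Type*} [TopologicalSpace H] (I : ModelWithCorners ℝ E H)
  {M : Type*} [TopologicalSpace M] [ChartedSpace H M] [IsManifold I 1 M]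

/-- The components in the chart at `x` of tangent vectors at `y`. -/
def tangentCoord (x y : M) : TangentSpace I y →L[ℝ] E :=
  fderivWithin ℝ ((chartAt H x).extend I ∘ ((chartAt H y).extend I).symm) (Set.range I)
        ((chartAt H y).extend I y)

theorem tangentCoord_eq_mfderiv {x y : M} (hy : y ∈ (chartAt H x).source) :
    tangentCoord I x y = mfderiv I 𝓘(ℝ, E) (extChartAt I x) y := by
  rw [← TangentBundle.continuousLinearMapAt_trivializationAt hy]
  ext v
  rw [Trivialization.continuousLinearMapAt_apply, Trivialization.linearMapAt_apply]
  exact (if_pos hy).symm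

theorem tangentCoord_self (x : M) (v : TangentSpace I x) : tangentCoord I x x v = (v : E) := by
  exact (tangentBundleCore I M).coordChange_self (achart H x) x (mem_chart_source H x) v

theorem tangentCoord_bijective {x y : M} (hy : y ∈ (chartAt H x).source) :
    Function.Bijective (tangentCoord I x y) := by
  have h := (Trivialization.continuousLinearEquivAt ℝ
    (trivializationAt E (TangentSpace I) x) y hy).bijective
  exact h

theorem HasVelocityAt.tangentCoord {γ : ℝ → M} {t : ℝ} {y : M} {v : TangentSpace I y}
    (h : HasVelocityAt I γ t y v) {x : M} (hy : y ∈ (chartAt H x).source) :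
    HasDerivAt (fun s ↦ extChartAt I x (γ s)) (tangentCoord I x y v) t := by
  rw [tangentCoord_eq_mfderiv I hy]
  exact (h.comp (mdifferentiableAt_extChartAt hy)).hasDerivAt

end Coord

section Connection
variable {E : Type*} [NormedAddCommGroup E] [NormedSpace ℝ E]
  {H : Type*} [TopologicalSpace H] {I : ModelWithCorners ℝ E H}
  {M : Type*} [TopologicalSpace M] [ChartedSpace H M] [IsManifold I 1 M]

theorem mdifferentiableAt_tangentCoord {σ : Π x : M, TangentSpace I x} {x : M}
    (h : MDifferentiableAt I I.tangent (fun y ↦ (⟨y, σ y⟩ : TangentBundle I M)) x) :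
    MDifferentiableAt I 𝓘(ℝ, E) (fun y ↦ tangentCoord I x y (σ y)) x :=
  (mdifferentiableAt_section _ σ).1 h

/-- In the chart at `x`, a covariant derivative is the derivative of the components corrected by
Christoffel symbols. -/
theorem exists_christoffel [FiniteDimensional ℝ E] [IsManifold I 2 M]
    (cov : CovariantDerivative I E (TangentSpace I : M → Type _)) (x : M) :
    ∃ Γ : TangentSpace I x →L[ℝ] TangentSpace I x →L[ℝ] E,
      ∀ σ : Π x : M, TangentSpace I x,
        MDifferentiableAt I I.tangent (fun y ↦ (⟨y, σ y⟩ : TangentBundle I M)) x →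
        ∀ v : TangentSpace I x, tangentCoord I x x (cov σ x v) =
          mvfderiv I (fun y ↦ tangentCoord I x y (σ y)) x v + Γ (σ x) v := by
  have : IsManifold I (1 + 1) M := by
    have : (1 + 1 : WithTop ℕ∞) = 2 := by norm_num
    rw [this]; infer_instance
  let cov' : (Π y : M, TangentSpace I y) → (Π y : M, TangentSpace I y →L[ℝ] TangentSpace I y) :=
    fun σ y ↦ mvfderiv I (fun y ↦ tangentCoord I x y (σ y)) y
  -- The Leibniz rule for `cov'` at `y` produces `tangentCoord I x y (σ y)`, which is `σ y` itself
  -- only at `y = x`; hence the singleton.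
  have hcov' : IsCovariantDerivativeOn E cov' {x} := by
    constructor
    · intro σ σ' y hσ hσ' hy
      obtain rfl : y = x := hy
      have h1 : mvfderiv I (fun z ↦ tangentCoord I y z ((σ + σ') z)) y =
          mvfderiv I ((fun z ↦ tangentCoord I y z (σ z)) + fun z ↦ tangentCoord I y z (σ' z)) y :=
        congrArg (fun f : M → E ↦ mvfderiv I f y)
          (funext fun z ↦ map_add (tangentCoord I y z) (σ z) (σ' z))
      exact h1.trans (mvfderiv_add (mdifferentiableAt_tangentCoord hσ)
        (mdifferentiableAt_tangentCoord hσ'))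
    · intro σ g y hσ hg hy
      obtain rfl : y = x := hy
      have h1 : mvfderiv I (fun z ↦ tangentCoord I y z ((g • σ) z)) y =
          mvfderiv I (g • fun z ↦ tangentCoord I y z (σ z)) y :=
        congrArg (fun f : M → E ↦ mvfderiv I f y)
          (funext fun z ↦ map_smul (tangentCoord I y z) (g z) (σ z))
      have h2 := h1.trans (mvfderiv_smul hg (mdifferentiableAt_tangentCoord hσ))
      rw [tangentCoord_self] at h2
      exact h2
  -- The difference of two covariant derivatives is tensorial; its value at `x` is the Christoffel
  -- term.
  refine ⟨(cov.isCovariantDerivativeOn (s := {x})).difference hcov' x, fun σ hσ v ↦ ?_⟩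
  have h := IsCovariantDerivativeOn.difference_apply (cov.isCovariantDerivativeOn (s := {x}))
    hcov' rfl hσ
  rw [tangentCoord_self]
  have h2 : (IsCovariantDerivativeOn.difference (cov.isCovariantDerivativeOn (s := {x}))
    hcov' x (σ x) v : TangentSpace I x) = cov σ x v - cov' σ x v := by rw [h]; rfl
  exact (sub_eq_iff_eq_add'.1 h2.symm)

/-- The covariant derivative in the direction of the velocity of a curve only depends on the values
of the vector field on the curve. -/
theorem exists_christoffel_curve [FiniteDimensional ℝ E] [IsManifold I 2 M]
    (cov : CovariantDerivative I E (TangentSpace I : M → Type _)) (x : M) :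
    ∃ Γ : TangentSpace I x →L[ℝ] TangentSpace I x →L[ℝ] E,
      ∀ σ : Π x : M, TangentSpace I x,
        MDifferentiableAt I I.tangent (fun y ↦ (⟨y, σ y⟩ : TangentBundle I M)) x →
        ∀ (v : TangentSpace I x) (γ : ℝ → M), HasVelocityAt I γ 0 x v →
          HasDerivAt (fun t ↦ tangentCoord I x (γ t) (σ (γ t)))
            (tangentCoord I x x (cov σ x v) - Γ (σ x) v) 0 := by
  obtain ⟨Γ, hΓ⟩ := exists_christoffel cov x
  refine ⟨Γ, fun σ hσ v γ hγ ↦ ?_⟩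
  rw [hΓ σ hσ v, add_sub_cancel_right]
  exact hγ.hasDerivAt_comp (mdifferentiableAt_tangentCoord hσ)

/-- The covariant derivative of a vector field which is a combination of other ones along a
curve. -/
theorem cov_eq_sum_of_curve [FiniteDimensional ℝ E] [IsManifold I 2 M]
    (cov : CovariantDerivative I E (TangentSpace I : M → Type _)) {ι : Type*} [Fintype ι]
    {x : M} {v : TangentSpace I x} {γ : ℝ → M} (hγ : HasVelocityAt I γ 0 x v)
    {σ : Π x : M, TangentSpace I x} {V : ι → Π x : M, TangentSpace I x}
    (hσ : MDifferentiableAt I I.tangent (fun y ↦ (⟨y, σ y⟩ : TangentBundle I M)) x)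
    (hV : ∀ i, MDifferentiableAt I I.tangent (fun y ↦ (⟨y, V i y⟩ : TangentBundle I M)) x)
    {c : ι → ℝ → ℝ} {c' : ι → ℝ} (hc : ∀ i, HasDerivAt (c i) (c' i) 0)
    (h : ∀ᶠ t in 𝓝 (0 : ℝ), σ (γ t) = ∑ i, c i t • V i (γ t)) :
    cov σ x v = ∑ i, (c' i • V i x + c i 0 • cov (V i) x v) := by
  have hx := hγ.1
  subst hx
  obtain ⟨Γ, hΓ⟩ := exists_christoffel_curve cov (γ 0)
  have h1 := hΓ σ hσ v γ hγ
  have h2 := HasDerivAt.fun_sum (u := Finset.univ)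
    fun i _ ↦ (hc i).smul (hΓ (V i) (hV i) v γ hγ)
  have h3 : (fun t ↦ tangentCoord I (γ 0) (γ t) (σ (γ t))) =ᶠ[𝓝 0]
      fun t ↦ ∑ i, c i t • tangentCoord I (γ 0) (γ t) (V i (γ t)) := by
    filter_upwards [h] with t ht
    simp only [ht, map_sum, map_smul]
  -- Two expressions for the derivative of the same components. The Christoffel terms cancel because
  -- `Γ` is linear in the value of the field.
  have h4 := h1.unique (h2.congr_of_eventuallyEq h3)
  apply (tangentCoord_bijective I (mem_chart_source H (γ 0))).1
  rw [sub_eq_iff_eq_add] at h4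
  rw [h4, h.self_of_nhds]
  simp only [map_sum, map_smul, map_add, sum_apply, smul_apply, smul_sub]
  rw [← Finset.sum_add_distrib]
  refine Finset.sum_congr rfl fun i _ ↦ ?_
  abel

/-- The components of a differentiable vector field along a map with respect to a differentiable
frame along the map are differentiable. -/
theorem mdifferentiableAt_frame_coeff [FiniteDimensional ℝ E]
    {E₁ : Type*} [NormedAddCommGroup E₁] [NormedSpace ℝ E₁]
    {H₁ : Type*} [TopologicalSpace H₁] {I₁ : ModelWithCorners ℝ E₁ H₁}
    {P : Type*} [TopologicalSpace P] [ChartedSpace H₁ P]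
    {ι : Type} [Fintype ι] {f : P → M} {W : ι → Π p : P, TangentSpace I (f p)} {ζ : P → ι → ℝ}
    {p₀ : P}
    (hframe : ∀ p, Function.Bijective fun c : ι → ℝ ↦ ∑ i, c i • W i p)
    (hW : ∀ i, MDifferentiableAt I₁ I.tangent (fun p ↦ (⟨f p, W i p⟩ : TangentBundle I M)) p₀)
    (hζ : MDifferentiableAt I₁ I.tangent
      (fun p ↦ (⟨f p, ∑ i, ζ p i • W i p⟩ : TangentBundle I M)) p₀) :
    MDifferentiableAt I₁ 𝓘(ℝ, ι → ℝ) ζ p₀ := by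
  classical
  have hf : MDifferentiableAt I₁ I f p₀ := ((mdifferentiableAt_totalSpace _ _).1 hζ).1
  have hζ' : MDifferentiableAt I₁ 𝓘(ℝ, E)
      (fun p ↦ tangentCoord I (f p₀) (f p) (∑ i, ζ p i • W i p)) p₀ :=
    ((mdifferentiableAt_totalSpace _ _).1 hζ).2
  have hW' (i : ι) : MDifferentiableAt I₁ 𝓘(ℝ, E)
      (fun p ↦ tangentCoord I (f p₀) (f p) (W i p)) p₀ :=
    ((mdifferentiableAt_totalSpace _ _).1 (hW i)).2
  -- `A p` is the frame at `p` read in the chart. The coefficients are `(A p)⁻¹` applied to the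
  -- components of the field, and inversion of operators is smooth.
  let A : P → (ι → ℝ) →L[ℝ] E := fun p ↦
    ∑ i, (ContinuousLinearMap.proj (R := ℝ) (φ := fun _ : ι ↦ ℝ) i).smulRight
      (tangentCoord I (f p₀) (f p) (W i p))
  have hAapp (p : P) (c : ι → ℝ) :
      A p c = tangentCoord I (f p₀) (f p) (∑ i, c i • W i p) := by
    simp [A, map_sum, map_smul]
  have hA : MDifferentiableAt I₁ 𝓘(ℝ, (ι → ℝ) →L[ℝ] E) A p₀ := by
    have hi (i : ι) : MDifferentiableAt I₁ 𝓘(ℝ, (ι → ℝ) →L[ℝ] E) (fun p ↦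
        (ContinuousLinearMap.proj (R := ℝ) (φ := fun _ : ι ↦ ℝ) i).smulRight
          (tangentCoord I (f p₀) (f p) (W i p))) p₀ :=
      ((ContinuousLinearMap.smulRightL ℝ (ι → ℝ) E (ContinuousLinearMap.proj (R := ℝ)
        (φ := fun _ : ι ↦ ℝ) i)).mdifferentiableAt.comp p₀ (hW' i))
    have := MDifferentiableAt.sum (t := Finset.univ) fun i _ ↦ hi i
    refine this.congr_of_eventuallyEq (.of_forall fun p ↦ ?_)
    ext c
    simp [A]
  have hbij (p : P) (hp : f p ∈ (chartAt H (f p₀)).source) : Function.Bijective (A p) := by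
    rw [show ⇑(A p) = _ from funext (hAapp p)]
    exact (tangentCoord_bijective I hp).comp (hframe p)
  have hinv (p : P) (hp : f p ∈ (chartAt H (f p₀)).source) : (A p).IsInvertible := by
    refine ⟨(LinearEquiv.ofBijective (A p).toLinearMap (hbij p hp)).toContinuousLinearEquiv, ?_⟩
    ext c
    rfl
  have hev : ∀ᶠ p in 𝓝 p₀, ζ p =
      (A p).inverse (tangentCoord I (f p₀) (f p) (∑ i, ζ p i • W i p)) := by
    filter_upwards [hf.continuousAt ((chartAt H (f p₀)).open_source.mem_nhds
      (mem_chart_source H (f p₀)))] with p hp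
    rw [← hAapp]
    exact ((hinv p hp).inverse_apply_eq.2 rfl).symm
  have hd := ((hinv p₀ (mem_chart_source H (f p₀))).contDiffAt_map_inverse (n := 1)).differentiableAt
    one_ne_zero |>.mdifferentiableAt
  exact ((hd.comp p₀ hA).clm_apply hζ').congr_of_eventuallyEq hev

end Connection

/-! ### Left invariant vector fields and their integral curves -/

section InvariantFields
variable {E : Type*} [NormedAddCommGroup E] [NormedSpace ℝ E]
  {H : Type*} [TopologicalSpace H] {I : ModelWithCorners ℝ E H}
  {G : Type*} [TopologicalSpace G] [ChartedSpace H G] [Group G]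

theorem isExp_smul {γ : ℝ → G} {X : GroupLieAlgebra I G}
    (hγ : ContMDiff 𝓘(ℝ) I ∞ γ) (hadd : ∀ s t, γ (s + t) = γ s * γ t)
    (hX : HasVelocityAt I γ 0 1 X) (t : ℝ) : IsExp I (t • X) (γ t) := by
  refine ⟨fun s ↦ γ (t * s), hγ.comp (contMDiff_const.mul contMDiff_id), fun r s ↦ ?_, ?_, ?_⟩
  · exact (congrArg γ (mul_add t r s)).trans (hadd _ _)
  · have hd : HasDerivAt (fun s : ℝ ↦ t * s) t 0 := by
      simpa using (hasDerivAt_id (0 : ℝ)).const_mul t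
    exact hX.comp_real hd (mul_zero t)
  · simp

theorem mulInvariantVectorField_one (X : GroupLieAlgebra I G) :
    mulInvariantVectorField X (1 : G) = X := by
  have : (fun g : G ↦ 1 * g) = id := by ext; simp
  unfold mulInvariantVectorField
  rw [this, mfderiv_id]
  rfl

variable [LieGroup I ∞ G]

theorem mdifferentiable_mul_left (a : G) : MDifferentiable I I (fun g : G ↦ a * g) :=
  (contMDiff_mul_left (I := I) (n := ∞)).mdifferentiable (by simp)

theorem HasVelocityAt.mul_left {γ : ℝ → G} {t : ℝ} {X : GroupLieAlgebra I G}
    (h : HasVelocityAt I γ t 1 X) (a : G) :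
    HasVelocityAt I (fun s ↦ a * γ s) t a (mulInvariantVectorField X a) := by
  have := h.comp (mdifferentiable_mul_left (I := I) a 1)
  exact ⟨this.1.trans (mul_one a), this.2⟩

theorem mfderiv_mul_left_mulInvariantVectorField (a b : G) (X : GroupLieAlgebra I G) :
    mfderiv I I (fun g : G ↦ a * g) b (mulInvariantVectorField X b) =
      (mulInvariantVectorField X (a * b) : E) := by
  have h : (fun g : G ↦ a * b * g) = (fun g ↦ a * g) ∘ fun g ↦ b * g := by
    ext g; simp [mul_assoc]
  have h2 := mfderiv_comp (1 : G) (mdifferentiable_mul_left (I := I) a (b * 1))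
    (mdifferentiable_mul_left (I := I) b 1)
  rw [← h, mul_one] at h2
  exact (DFunLike.congr_fun h2 X).symm

/-- The value at `g` is the differential of multiplication at `(g, 1)` applied to `(0, X)`, so the
field is the tangent map of multiplication composed with a smooth section. -/
theorem smoothField_mulInvariantVectorField (X : GroupLieAlgebra I G) :
    SmoothField I (mulInvariantVectorField X : Π g : G, TangentSpace I g) := by
  have h1 : ContMDiff I (I.tangent.prod I.tangent) ∞ (fun g : G ↦
      ((⟨g, 0⟩, ⟨1, X⟩) : TangentBundle I G × TangentBundle I G)) :=
    (contMDiff_zeroSection ℝ (TangentSpace I : G → Type _)).prodMk contMDiff_const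
  have h2 : ContMDiff (I.tangent.prod I.tangent) (I.prod I).tangent ∞
    (equivTangentBundleProd I G I G).symm := contMDiff_equivTangentBundleProd_symm
  have h3 : ContMDiff (I.prod I).tangent I.tangent ∞
      (tangentMap (I.prod I) I fun p : G × G ↦ p.1 * p.2) :=
    (contMDiff_mul I ∞).contMDiff_tangentMap le_rfl
  have h := (h3.comp h2).comp h1
  unfold SmoothField
  convert! h with g
  · simp
  · have hm : MDifferentiableAt (I.prod I) I (fun p : G × G ↦ p.1 * p.2) (g, 1) :=
      (contMDiff_mul I ∞).mdifferentiableAt (by simp)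
    have e (L₁ L₂ : E →L[ℝ] E) (x : E) : L₂ x = L₁ 0 + L₂ x := by simp
    exact (e (mfderiv I I (fun z : G ↦ z * 1) g) (mfderiv I I (fun z : G ↦ g * z) 1) X).trans
      (mfderiv_prod_eq_add_apply (v := (((0 : E), (X : E)) :
        TangentSpace (I.prod I) ((g, 1) : G × G))) hm).symm

theorem mdifferentiableAt_mulInvariantVectorField' (X : GroupLieAlgebra I G) (g : G) :
    MDifferentiableAt I I.tangent
      (fun g : G ↦ (⟨g, mulInvariantVectorField X g⟩ : TangentBundle I G)) g :=
  (smoothField_mulInvariantVectorField X).mdifferentiable (by simp) g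

theorem isMIntegralCurveOn_mul_left {γ : ℝ → G} {X : GroupLieAlgebra I G} {s : Set ℝ}
    (h : IsMIntegralCurveOn γ (mulInvariantVectorField X : Π g : G, TangentSpace I g) s) (a : G) :
    IsMIntegralCurveOn (fun t ↦ a * γ t)
      (mulInvariantVectorField X : Π g : G, TangentSpace I g) s := by
  intro t ht
  have h1 := (mdifferentiable_mul_left (I := I) a (γ t)).hasMFDerivAt.comp_hasMFDerivWithinAt t
    (h t ht)
  have e (L : E →L[ℝ] E) (v w : E) (hw : L v = w) :
      L.comp ((1 : ℝ →L[ℝ] ℝ).smulRight v) = (1 : ℝ →L[ℝ] ℝ).smulRight w := by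
    ext; simp [hw]
  exact (e _ _ _ (mfderiv_mul_left_mulInvariantVectorField a (γ t) X)) ▸ h1

variable [BoundarylessManifold I G] [T2Space G]

/-- Both `t ↦ γ (s + t)` and `t ↦ γ s * γ t` are integral curves starting at `γ s`; uniqueness
identifies them. -/
theorem isMIntegralCurve_map_add {γ : ℝ → G} {X : GroupLieAlgebra I G} (hγ0 : γ 0 = 1)
    (h : IsMIntegralCurve γ (mulInvariantVectorField X : Π g : G, TangentSpace I g)) (s t : ℝ) :
    γ (s + t) = γ s * γ t := by
  have hv : ContMDiff I I.tangent 1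
      (fun g : G ↦ (⟨g, mulInvariantVectorField X g⟩ : TangentBundle I G)) :=
    (smoothField_mulInvariantVectorField X).of_le (by simp)
  have h1 := h.comp_add s
  have h2 : IsMIntegralCurve (fun t ↦ γ s * γ t)
      (mulInvariantVectorField X : Π g : G, TangentSpace I g) := by
    rw [isMIntegralCurve_iff_isMIntegralCurveOn] at h ⊢
    exact isMIntegralCurveOn_mul_left h (γ s)
  have := isMIntegralCurve_Ioo_eq_of_contMDiff_boundaryless (t₀ := 0) hv h1 h2 (by simp [hγ0])
  simpa [add_comm] using congrFun this t

/-- Left invariant vector fields are complete. -/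
theorem exists_isMIntegralCurve_mulInvariantVectorField [CompleteSpace E] (X : GroupLieAlgebra I G) :
    ∃ γ : ℝ → G, γ 0 = 1 ∧
      IsMIntegralCurve γ (mulInvariantVectorField X : Π g : G, TangentSpace I g) := by
  have hv : ContMDiff I I.tangent 1
      (fun g : G ↦ (⟨g, mulInvariantVectorField X g⟩ : TangentBundle I G)) :=
    (smoothField_mulInvariantVectorField X).of_le (by simp)
  obtain ⟨γ, hγ0, hγ⟩ := exists_isMIntegralCurveAt_of_contMDiffAt_boundaryless 0
    (hv.contMDiffAt (x := 1))
  obtain ⟨ε, hε, hγ⟩ := isMIntegralCurveAt_iff'.1 hγ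
  -- Left translates of one local solution through `1` give solutions through every point on the
  -- same interval `(-ε, ε)`; this uniform lifetime forces completeness.
  refine exists_isMIntegralCurve_of_isMIntegralCurveOn hv hε (fun x ↦ ⟨fun t ↦ x * γ t, ?_, ?_⟩) 1
  · simp [hγ0]
  · rw [Real.ball_eq_Ioo, zero_sub, zero_add] at hγ
    exact isMIntegralCurveOn_mul_left hγ x

end InvariantFields

/-! ### Smoothness of integral curves and one-parameter subgroups -/

section ODE
variable {E : Type*} [NormedAddCommGroup E] [NormedSpace ℝ E]

/-- Bootstrapping: if `u` is `C^n`, then so is `u' = w ∘ u`, hence `u` is `C^(n+1)`. -/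
theorem contDiffOn_of_hasDerivAt {w : E → E} {Ω : Set E} (hw : ContDiffOn ℝ ∞ w Ω)
    {u : ℝ → E} {s : Set ℝ} (hs : IsOpen s) (hu : ∀ t ∈ s, HasDerivAt u (w (u t)) t)
    (hmem : ∀ t ∈ s, u t ∈ Ω) : ContDiffOn ℝ ∞ u s := by
  rw [contDiffOn_infty]
  intro n
  induction n with
  | zero => exact contDiffOn_zero.2 fun t ht ↦ (hu t ht).continuousAt.continuousWithinAt
  | succ n ih =>
    push_cast
    rw [contDiffOn_succ_iff_deriv_of_isOpen hs]
    refine ⟨fun t ht ↦ (hu t ht).differentiableAt.differentiableWithinAt, by simp, ?_⟩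
    refine ContDiffOn.congr (((contDiffOn_infty.1 hw) n).comp ih hmem) fun t ht ↦ ?_
    exact (hu t ht).deriv

end ODE

section IntegralCurve
variable {E : Type*} [NormedAddCommGroup E] [NormedSpace ℝ E]
  {M : Type*} [TopologicalSpace M] [ChartedSpace E M]

theorem hasVelocityAt_of_isMIntegralCurve {γ : ℝ → M} {v : Π g : M, TangentSpace 𝓘(ℝ, E) g}
    (h : IsMIntegralCurve γ v) (t : ℝ) : HasVelocityAt 𝓘(ℝ, E) γ t (γ t) (v (γ t)) := by
  refine ⟨rfl, ?_⟩
  have e (v : E) : (1 : ℝ →L[ℝ] ℝ).smulRight v = ContinuousLinearMap.toSpanSingleton ℝ v := by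
    ext; simp
  exact (e (v (γ t))) ▸ h t

/-- Integral curves of smooth vector fields are smooth. -/
theorem contMDiff_of_isMIntegralCurve [IsManifold 𝓘(ℝ, E) ∞ M] {γ : ℝ → M}
    {v : Π g : M, TangentSpace 𝓘(ℝ, E) g}
    (h : IsMIntegralCurve γ v) (hv : SmoothField 𝓘(ℝ, E) v) :
    ContMDiff 𝓘(ℝ) 𝓘(ℝ, E) ∞ γ := by
  intro t₀
  have hc : Continuous γ := continuous_iff_continuousAt.2 fun t ↦ (h t).continuousAt
  have : IsManifold 𝓘(ℝ, E) (∞ + 1) M := ‹IsManifold 𝓘(ℝ, E) ∞ M›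
  have hs : IsOpen (γ ⁻¹' (chartAt E (γ t₀)).source) :=
    (chartAt E (γ t₀)).open_source.preimage hc
  have hv' : ContMDiffOn 𝓘(ℝ, E) 𝓘(ℝ, E) ∞ (fun y ↦ tangentCoord 𝓘(ℝ, E) (γ t₀) y (v y))
      (chartAt E (γ t₀)).source :=
    (Trivialization.contMDiffOn_section_iff (n := ∞) (IB := 𝓘(ℝ, E))
      (trivializationAt E (TangentSpace 𝓘(ℝ, E)) (γ t₀))
      (chartAt E (γ t₀)).open_source subset_rfl).1 (ContMDiff.contMDiffOn hv)
  have hw : ContDiffOn ℝ ∞ (fun y ↦ tangentCoord 𝓘(ℝ, E) (γ t₀)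
      ((extChartAt 𝓘(ℝ, E) (γ t₀)).symm y) (v ((extChartAt 𝓘(ℝ, E) (γ t₀)).symm y)))
      (extChartAt 𝓘(ℝ, E) (γ t₀)).target := by
    refine contMDiffOn_iff_contDiffOn.1
      (hv'.comp (contMDiffOn_extChartAt_symm (γ t₀)) fun y hy ↦ ?_)
    have := (extChartAt 𝓘(ℝ, E) (γ t₀)).map_target hy
    rwa [extChartAt_source] at this
  have hu := contDiffOn_of_hasDerivAt hw hs (u := fun t ↦ extChartAt 𝓘(ℝ, E) (γ t₀) (γ t)) ?_ ?_
  · rw [contMDiffAt_iff_target]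
    refine ⟨hc.continuousAt, ?_⟩
    exact (hu.contDiffAt (hs.mem_nhds (mem_chart_source E (γ t₀)))).contMDiffAt
  · intro t ht
    have h1 := (hasVelocityAt_of_isMIntegralCurve h t).tangentCoord (x := γ t₀) _ ht
    rwa [(extChartAt 𝓘(ℝ, E) (γ t₀)).left_inv (by rwa [extChartAt_source])]
  · intro t ht
    exact (extChartAt 𝓘(ℝ, E) (γ t₀)).map_source (by rwa [extChartAt_source])

end IntegralCurve

section OneParameter
variable {E : Type*} [NormedAddCommGroup E] [NormedSpace ℝ E] [CompleteSpace E]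
  {G : Type*} [TopologicalSpace G] [T2Space G] [ChartedSpace E G] [Group G]
  [LieGroup 𝓘(ℝ, E) ∞ G]

/-- Every element of the Lie algebra generates a one-parameter subgroup. -/
theorem exists_oneParameterSubgroup (X : GroupLieAlgebra 𝓘(ℝ, E) G) :
    ∃ γ : ℝ → G, ContMDiff 𝓘(ℝ) 𝓘(ℝ, E) ∞ γ ∧ (∀ s t, γ (s + t) = γ s * γ t) ∧
      HasVelocityAt 𝓘(ℝ, E) γ 0 1 X := by
  obtain ⟨γ, hγ0, hγ⟩ := exists_isMIntegralCurve_mulInvariantVectorField X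
  refine ⟨γ, contMDiff_of_isMIntegralCurve hγ (smoothField_mulInvariantVectorField X),
    isMIntegralCurve_map_add hγ0 hγ, ?_⟩
  have h1 := hasVelocityAt_of_isMIntegralCurve hγ 0
  refine ⟨hγ0, ?_⟩
  have h3 := h1.2
  rw [hγ0] at h3
  exact mulInvariantVectorField_one X ▸ h3

end OneParameter

/-! ### The Lie bracket in a chart -/

section Bracket
variable {E : Type*} [NormedAddCommGroup E] [NormedSpace ℝ E]
  {M : Type*} [TopologicalSpace M] [ChartedSpace E M] [IsManifold 𝓘(ℝ, E) 1 M]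

theorem mpullbackWithin_extChartAt_symm_apply (x : M) (V : Π y : M, TangentSpace 𝓘(ℝ, E) y) {y : E}
    (hy : y ∈ (extChartAt 𝓘(ℝ, E) x).target) :
    mpullbackWithin 𝓘(ℝ, E) 𝓘(ℝ, E) (extChartAt 𝓘(ℝ, E) x).symm V (Set.range 𝓘(ℝ, E)) y =
      tangentCoord 𝓘(ℝ, E) x ((extChartAt 𝓘(ℝ, E) x).symm y)
        (V ((extChartAt 𝓘(ℝ, E) x).symm y)) := by
  have hz : (extChartAt 𝓘(ℝ, E) x).symm y ∈ (chartAt E x).source := by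
    have := (extChartAt 𝓘(ℝ, E) x).map_target hy
    rwa [extChartAt_source] at this
  rw [mpullbackWithin_apply, tangentCoord_eq_mfderiv _ hz]
  exact DFunLike.congr_fun (ContinuousLinearMap.inverse_eq
    (mfderivWithin_extChartAt_symm_comp_mfderiv_extChartAt hy)
    (mfderiv_extChartAt_comp_mfderivWithin_extChartAt_symm hy)) _

/-- The Lie bracket of vector fields in terms of the derivatives of their components. -/
theorem tangentCoord_mlieBracket {x : M} {V W : Π y : M, TangentSpace 𝓘(ℝ, E) y}
    (hV : MDifferentiableAt 𝓘(ℝ, E) 𝓘(ℝ, E).tangent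
      (fun y ↦ (⟨y, V y⟩ : TangentBundle 𝓘(ℝ, E) M)) x)
    (hW : MDifferentiableAt 𝓘(ℝ, E) 𝓘(ℝ, E).tangent
      (fun y ↦ (⟨y, W y⟩ : TangentBundle 𝓘(ℝ, E) M)) x) :
    tangentCoord 𝓘(ℝ, E) x x (mlieBracket 𝓘(ℝ, E) V W x) =
      mvfderiv 𝓘(ℝ, E) (fun y ↦ tangentCoord 𝓘(ℝ, E) x y (W y)) x (V x) -
      mvfderiv 𝓘(ℝ, E) (fun y ↦ tangentCoord 𝓘(ℝ, E) x y (V y)) x (W x) := by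
  let P : (Π y : M, TangentSpace 𝓘(ℝ, E) y) → E → E := fun V ↦
    mpullbackWithin 𝓘(ℝ, E) 𝓘(ℝ, E) (extChartAt 𝓘(ℝ, E) x).symm V (Set.range 𝓘(ℝ, E))
  let Q : (Π y : M, TangentSpace 𝓘(ℝ, E) y) → E → E := fun V y ↦
    tangentCoord 𝓘(ℝ, E) x ((extChartAt 𝓘(ℝ, E) x).symm y) (V ((extChartAt 𝓘(ℝ, E) x).symm y))
  have hPQ (V : Π y : M, TangentSpace 𝓘(ℝ, E) y) :
      P V =ᶠ[𝓝 (extChartAt 𝓘(ℝ, E) x x)] Q V := by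
    filter_upwards [extChartAt_target_mem_nhds x] with y hy
    exact mpullbackWithin_extChartAt_symm_apply x V hy
  have hQ (V : Π y : M, TangentSpace 𝓘(ℝ, E) y) : Q V (extChartAt 𝓘(ℝ, E) x x) = (V x : E) := by
    simp only [Q]
    rw [extChartAt_to_inv, tangentCoord_self]
  have key (V : Π y : M, TangentSpace 𝓘(ℝ, E) y)
      (hV : MDifferentiableAt 𝓘(ℝ, E) 𝓘(ℝ, E).tangent
        (fun y ↦ (⟨y, V y⟩ : TangentBundle 𝓘(ℝ, E) M)) x) (w : TangentSpace 𝓘(ℝ, E) x) :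
      mvfderiv 𝓘(ℝ, E) (fun y ↦ tangentCoord 𝓘(ℝ, E) x y (V y)) x w =
        fderiv ℝ (Q V) (extChartAt 𝓘(ℝ, E) x x) w := by
    rw [← fderivWithin_univ, ← ModelWithCorners.range_eq_univ 𝓘(ℝ, E)]
    exact DFunLike.congr_fun (if_pos (mdifferentiableAt_tangentCoord hV)) w
  have hinv := isInvertible_mfderiv_extChartAt (I := 𝓘(ℝ, E)) (mem_extChartAt_source x)
  -- The manifold bracket is the bracket of the chart representatives `P V`, `P W`, carried back to
  -- `x`. These agree near the centre with the component functions `Q V`, `Q W`.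
  have h1 : mlieBracket 𝓘(ℝ, E) V W x = (mfderiv 𝓘(ℝ, E) 𝓘(ℝ, E) (extChartAt 𝓘(ℝ, E) x) x).inverse
      (lieBracket ℝ (E := E) (Q V) (Q W) (extChartAt 𝓘(ℝ, E) x x)) := by
    rw [← (hPQ V).lieBracket_vectorField_eq (hPQ W), ← lieBracketWithin_univ,
      ← ModelWithCorners.range_eq_univ 𝓘(ℝ, E), ← Set.univ_inter (Set.range _)]
    rfl
  rw [tangentCoord_eq_mfderiv _ (mem_chart_source E x), key V hV, key W hW]
  have h2 : lieBracket ℝ (E := E) (Q V) (Q W) (extChartAt 𝓘(ℝ, E) x x) =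
      fderiv ℝ (Q W) (extChartAt 𝓘(ℝ, E) x x) (V x) -
        fderiv ℝ (Q V) (extChartAt 𝓘(ℝ, E) x x) (W x) := by
    rw [lieBracket_eq]
    simp only [hQ]
  exact (hinv.inverse_apply_eq.1 h1.symm).symm.trans h2

end Bracket

/-! ### The canonical connection of the group -/

section SecondDerivative
variable {V E : Type*} [NormedAddCommGroup V] [NormedSpace ℝ V] [NormedAddCommGroup E]
  [NormedSpace ℝ E]

theorem hasDerivAt_fderiv_smul {F : V → E} (hF : ContDiffAt ℝ 2 F 0) (a q : V) :
    HasDerivAt (fun t : ℝ ↦ fderiv ℝ F (t • a) q) (fderiv ℝ (fderiv ℝ F) 0 a q) 0 := by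
  have h1 : DifferentiableAt ℝ (fderiv ℝ F) 0 :=
    (hF.fderiv_right (m := 1) (by norm_num)).differentiableAt one_ne_zero
  have h2 : HasDerivAt (fun t : ℝ ↦ t • a) a 0 := by
    simpa using (hasDerivAt_id (0 : ℝ)).smul_const a
  have h3 : HasFDerivAt (fderiv ℝ F) (fderiv ℝ (fderiv ℝ F) 0) ((0 : ℝ) • a) := by
    rw [zero_smul]; exact h1.hasFDerivAt
  have h4 := h3.comp_hasDerivAt 0 h2
  have h5 := h4.clm_apply (hasDerivAt_const (0 : ℝ) q)
  rw [map_zero, add_zero] at h5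
  exact h5

end SecondDerivative

section Group
variable {G : Type*} [Group G]

theorem map_zero_eq_one_of_map_add {γ : ℝ → G} (h : ∀ s t, γ (s + t) = γ s * γ t) : γ 0 = 1 := by
  simpa using h 0 0

theorem map_neg_eq_inv_of_map_add {γ : ℝ → G} (h : ∀ s t, γ (s + t) = γ s * γ t) (t : ℝ) :
    γ (-t) = (γ t)⁻¹ := by
  rw [eq_inv_iff_mul_eq_one, ← h, neg_add_cancel, map_zero_eq_one_of_map_add h]

end Group

section Canonical
variable {E : Type*} [NormedAddCommGroup E] [NormedSpace ℝ E]
  {G : Type*} [TopologicalSpace G] [ChartedSpace E G] [Group G]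

theorem mem_antidiagonal (X : GroupLieAlgebra 𝓘(ℝ, E) G) :
    (((X : E), -(X : E)) : GroupLieAlgebra (𝓘(ℝ, E).prod 𝓘(ℝ, E)) (G × G)) ∈
      antidiagonal 𝓘(ℝ, E) (G := G) :=
  ⟨X, rfl⟩

/-- The one-parameter subgroup of `G × G` with velocity `(X, -X)`. -/
theorem hasVelocityAt_antidiagonal {γ : ℝ → G} {X : GroupLieAlgebra 𝓘(ℝ, E) G}
    (hX : HasVelocityAt 𝓘(ℝ, E) γ 0 1 X) :
    HasVelocityAt (𝓘(ℝ, E).prod 𝓘(ℝ, E)) (fun t ↦ (γ t, γ (-t))) 0 (1 : G × G)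
      ((X : E), -(X : E)) := by
  have h1 : HasVelocityAt 𝓘(ℝ, E) (fun t ↦ γ (-t)) 0 1 ((-1 : ℝ) • X) :=
    hX.comp_real (hasDerivAt_neg 0) neg_zero
  rw [neg_one_smul] at h1
  exact hX.prodMk h1

variable [LieGroup 𝓘(ℝ, E) ∞ G]

/-- The product `γ r * η s * γ t`, read in the chart at the identity. -/
def tripleProduct (γ η : ℝ → G) (p : ℝ × ℝ × ℝ) : E :=
  extChartAt 𝓘(ℝ, E) (1 : G) (γ p.1 * η p.2.1 * γ p.2.2)

theorem contMDiff_mul_mul {γ η : ℝ → G} (hγ : ContMDiff 𝓘(ℝ) 𝓘(ℝ, E) ∞ γ)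
    (hη : ContMDiff 𝓘(ℝ) 𝓘(ℝ, E) ∞ η) : ContMDiff 𝓘(ℝ, ℝ × ℝ × ℝ) 𝓘(ℝ, E) ∞
      (fun p : ℝ × ℝ × ℝ ↦ γ p.1 * η p.2.1 * γ p.2.2) :=
  ((hγ.comp contDiff_fst.contMDiff).mul
    (hη.comp (contDiff_fst.comp contDiff_snd).contMDiff)).mul
      (hγ.comp (contDiff_snd.comp contDiff_snd).contMDiff)

theorem contDiffAt_tripleProduct {γ η : ℝ → G} (hγ : ContMDiff 𝓘(ℝ) 𝓘(ℝ, E) ∞ γ)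
    (hη : ContMDiff 𝓘(ℝ) 𝓘(ℝ, E) ∞ η) (hγ0 : γ 0 = 1) (hη0 : η 0 = 1) :
    ContDiffAt ℝ ∞ (tripleProduct (E := E) γ η) 0 := by
  refine ContMDiffAt.contDiffAt ?_
  have h1 : (γ (0 : ℝ × ℝ × ℝ).1 * η (0 : ℝ × ℝ × ℝ).2.1 * γ (0 : ℝ × ℝ × ℝ).2.2) = 1 := by
    simp [hγ0, hη0]
  refine ContMDiffAt.comp (0 : ℝ × ℝ × ℝ) (I' := 𝓘(ℝ, E)) (g := extChartAt 𝓘(ℝ, E) (1 : G))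
    ?_ (contMDiff_mul_mul hγ hη).contMDiffAt
  rw [h1]
  exact contMDiffAt_extChartAt

/-- Translates a velocity of the triple product in `G` into a first derivative of `tripleProduct`.
Differentiating once more at `0` expresses the derivative of a field along a curve as a second
derivative. -/
theorem eventually_tangentCoord_eq_fderiv {γ η : ℝ → G} (hγ : ContMDiff 𝓘(ℝ) 𝓘(ℝ, E) ∞ γ)
    (hη : ContMDiff 𝓘(ℝ) 𝓘(ℝ, E) ∞ η) (hγ0 : γ 0 = 1) (hη0 : η 0 = 1) :
    ∀ᶠ p : ℝ × ℝ × ℝ in 𝓝 0, ∀ (q : ℝ × ℝ × ℝ) (y : G) (v : TangentSpace 𝓘(ℝ, E) y),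
      HasVelocityAt 𝓘(ℝ, E) (fun s : ℝ ↦ γ (p + s • q).1 * η (p + s • q).2.1 * γ (p + s • q).2.2)
        0 y v → tangentCoord 𝓘(ℝ, E) 1 y v = fderiv ℝ (tripleProduct (E := E) γ η) p q := by
  have h1 := ((contDiffAt_tripleProduct hγ hη hγ0 hη0).of_le
    (show (1 : WithTop ℕ∞) ≤ ∞ by simp)).eventually (by simp)
  have h2 : ∀ᶠ p : ℝ × ℝ × ℝ in 𝓝 0, γ p.1 * η p.2.1 * γ p.2.2 ∈ (chartAt E (1 : G)).source := by
    refine (contMDiff_mul_mul hγ hη).continuous.continuousAt.eventually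
      ((chartAt E (1 : G)).open_source.mem_nhds ?_)
    simp [hγ0, hη0]
  filter_upwards [h1, h2] with p hp1 hp2 q y v hv
  have hy : y = γ p.1 * η p.2.1 * γ p.2.2 := by
    rw [← hv.1]; simp
  have h3 := hv.tangentCoord (x := 1) _ (hy ▸ hp2)
  have h4 : HasDerivAt (fun s : ℝ ↦ p + s • q) q 0 := by
    simpa using ((hasDerivAt_id (0 : ℝ)).smul_const q).const_add p
  have h5 : HasFDerivAt (tripleProduct (E := E) γ η) (fderiv ℝ (tripleProduct (E := E) γ η) p)
      (p + (0 : ℝ) • q) := by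
    rw [zero_smul, add_zero]
    exact (hp1.differentiableAt (by simp)).hasFDerivAt
  have h6 := h5.comp_hasDerivAt 0 h4
  exact h3.unique h6

theorem contDiffAt_two_tripleProduct {γ η : ℝ → G} (hγ : ContMDiff 𝓘(ℝ) 𝓘(ℝ, E) ∞ γ)
    (hη : ContMDiff 𝓘(ℝ) 𝓘(ℝ, E) ∞ η) (hγ0 : γ 0 = 1) (hη0 : η 0 = 1) :
    ContDiffAt ℝ 2 (tripleProduct (E := E) γ η) 0 :=
  (contDiffAt_tripleProduct hγ hη hγ0 hη0).of_le (WithTop.coe_le_coe.2 (le_top : (2 : ℕ∞) ≤ ⊤))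

theorem mdifferentiable_orbit : MDifferentiable (𝓘(ℝ, E).prod 𝓘(ℝ, E)) 𝓘(ℝ, E)
    (fun p : G × G ↦ p.1 * (1 : G) * p.2⁻¹) :=
  ((contMDiff_fst.mul contMDiff_const).mul contMDiff_snd.inv :
    ContMDiff (𝓘(ℝ, E).prod 𝓘(ℝ, E)) 𝓘(ℝ, E) ∞
      (fun p : G × G ↦ p.1 * (1 : G) * p.2⁻¹)).mdifferentiable (by simp)

/-- The factor `2` arises because the curve `(γ t, γ (-t))` projects to `γ t * (γ (-t))⁻¹ = γ (2 *
t)`. -/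
theorem dproj_antidiagonal {γ : ℝ → G} {X : GroupLieAlgebra 𝓘(ℝ, E) G}
    (hadd : ∀ s t, γ (s + t) = γ s * γ t) (hX : HasVelocityAt 𝓘(ℝ, E) γ 0 1 X) :
    dproj (𝓘(ℝ, E).prod 𝓘(ℝ, E)) 𝓘(ℝ, E) (fun (p : G × G) (a : G) ↦ p.1 * a * p.2⁻¹) 1
      ((X : E), -(X : E)) = (2 : ℝ) • X := by
  have h1 := (hasVelocityAt_antidiagonal hX).comp (mdifferentiable_orbit (E := E) (1 : G × G))
  have h2 : HasVelocityAt 𝓘(ℝ, E) (fun t ↦ γ (2 * t)) 0 1 ((2 : ℝ) • X) := by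
    refine hX.comp_real ?_ (mul_zero 2)
    simpa using (hasDerivAt_id (0 : ℝ)).const_mul 2
  have h3 : (fun t ↦ γ (2 * t)) = fun t ↦ γ t * 1 * (γ (-t))⁻¹ := by
    funext t
    rw [map_neg_eq_inv_of_map_add hadd, inv_inv, mul_one, ← hadd, two_mul]
  rw [h3] at h2
  exact HasVelocityAt.unique (x := (1 : G)) ⟨h2.1, h1.2⟩ h2

variable [FiniteDimensional ℝ E] [T2Space G]

/-- Write `B_rs` and `B_st` for the mixed second derivatives at `0` of `γ r * η s * γ t` in the
chart. Then `∇_X Y = B_rs + Γ(Y, X)` and `[X, Y] = B_rs - B_st`. The field `(Y, -Y)^#` equals `2Y`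
at `1` and has zero derivative in the direction `2X`, so `0 = 2 (B_rs + B_st) + 4 Γ(Y, X)`.
Eliminating `Γ` gives `½ (B_rs - B_st)`. -/
theorem IsCanonicalConnection.cov_one
    {cov : CovariantDerivative 𝓘(ℝ, E) E (TangentSpace 𝓘(ℝ, E) : G → Type _)}
    (h : IsCanonicalConnection 𝓘(ℝ, E) cov) (X Y : GroupLieAlgebra 𝓘(ℝ, E) G) :
    cov (mulInvariantVectorField Y) 1 X = (1 / 2 : ℝ) • ⁅X, Y⁆ := by
  have : CompleteSpace E := FiniteDimensional.complete ℝ E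
  obtain ⟨γ, hγ, hγmul, hX⟩ := exists_oneParameterSubgroup X
  obtain ⟨η, hη, hηmul, hY⟩ := exists_oneParameterSubgroup Y
  have hγ0 := hX.1
  have hη0 := hY.1
  set F := tripleProduct (E := E) γ η with hFdef
  have hF := contDiffAt_two_tripleProduct hγ hη hγ0 hη0
  have hcoord := eventually_tangentCoord_eq_fderiv hγ hη hγ0 hη0
  set B := fderiv ℝ (fderiv ℝ F) 0 with hB
  have hsymm (a q : ℝ × ℝ × ℝ) : B a q = B q a := (hF.isSymmSndFDerivAt (by simp)) a q
  have hcoord' (a : ℝ × ℝ × ℝ) : ∀ᶠ t : ℝ in 𝓝 0, ∀ (q : ℝ × ℝ × ℝ) (y : G)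
      (v : TangentSpace 𝓘(ℝ, E) y),
      HasVelocityAt 𝓘(ℝ, E) (fun s : ℝ ↦ γ (t • a + s • q).1 * η (t • a + s • q).2.1 *
        γ (t • a + s • q).2.2) 0 y v → tangentCoord 𝓘(ℝ, E) 1 y v = fderiv ℝ F (t • a) q := by
    have : Filter.Tendsto (fun t : ℝ ↦ t • a) (𝓝 0) (𝓝 0) := by
      have : ContinuousAt (fun t : ℝ ↦ t • a) 0 := by fun_prop
      simpa [ContinuousAt] using this
    exact this.eventually hcoord
  obtain ⟨Γ, hΓ⟩ := exists_christoffel_curve cov (1 : G)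
  -- the components of the left invariant field `Y` along `γ`
  have hYγ : HasDerivAt (fun r ↦ tangentCoord 𝓘(ℝ, E) 1 (γ r) (mulInvariantVectorField Y (γ r)))
      (B (1, 0, 0) (0, 1, 0)) 0 := by
    refine (hasDerivAt_fderiv_smul hF (1, 0, 0) (0, 1, 0)).congr_of_eventuallyEq ?_
    filter_upwards [hcoord' (1, 0, 0)] with r hr
    refine hr (0, 1, 0) _ _ ?_
    simpa [hγ0] using hY.mul_left (γ r)
  -- the components of the left invariant field `X` along `η`
  have hXη : HasDerivAt (fun s ↦ tangentCoord 𝓘(ℝ, E) 1 (η s) (mulInvariantVectorField X (η s)))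
      (B (0, 1, 0) (0, 0, 1)) 0 := by
    refine (hasDerivAt_fderiv_smul hF (0, 1, 0) (0, 0, 1)).congr_of_eventuallyEq ?_
    filter_upwards [hcoord' (0, 1, 0)] with r hr
    refine hr (0, 0, 1) _ _ ?_
    simpa [hγ0] using hX.mul_left (η r)
  obtain ⟨V, ⟨⟨U, hU, hVU⟩, hV⟩, hVcov⟩ := h.connection_function ⟨_, mem_antidiagonal Y⟩
  have hVd : MDifferentiableAt 𝓘(ℝ, E) 𝓘(ℝ, E).tangent
      (fun y ↦ (⟨y, V y⟩ : TangentBundle 𝓘(ℝ, E) G)) 1 :=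
    (ContMDiffOn.contMDiffAt hVU hU).mdifferentiableAt (by simp)
  -- At `exp t(X, -X) = (γ t, γ (-t))` the left invariant field `(Y, -Y)` is the velocity of `s ↦ (γ
  -- t * η s, γ (-t) * η (-s))`, which projects to `γ t * η (2 * s) * γ t`.
  have hVvel : ∀ᶠ t in 𝓝 (0 : ℝ), HasVelocityAt 𝓘(ℝ, E) (fun s ↦ γ t * η (2 * s) * γ t) 0
      (γ (2 * t)) (V (γ (2 * t))) := by
    have htend : Filter.Tendsto (fun t : ℝ ↦ t • (((X : E), -(X : E)) :
        GroupLieAlgebra (𝓘(ℝ, E).prod 𝓘(ℝ, E)) (G × G))) (𝓝 0) (𝓝 0) := by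
      have : Continuous (fun t : ℝ ↦ t • (((X : E), -(X : E)) :
        GroupLieAlgebra (𝓘(ℝ, E).prod 𝓘(ℝ, E)) (G × G))) := continuous_id.smul continuous_const
      simpa using this.tendsto 0
    filter_upwards [htend.eventually hV] with t hVt
    have hexp := isExp_smul (G := G × G) (γ := fun t ↦ (γ t, γ (-t)))
      (hγ.prodMk (hγ.comp contDiff_neg.contMDiff))
      (fun s t ↦ Prod.ext (hγmul s t) ((congrArg γ (neg_add s t)).trans (hγmul _ _)))
      (hasVelocityAt_antidiagonal hX) t
    have h1 := hVt (Submodule.smul_mem _ t (mem_antidiagonal X)) _ hexp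
    have h2 := ((hasVelocityAt_antidiagonal hY).mul_left (γ t, γ (-t))).comp
      (mdifferentiable_orbit (E := E) (γ t, γ (-t)))
    have he : γ t * 1 * (γ (-t))⁻¹ = γ (2 * t) := by
      rw [map_neg_eq_inv_of_map_add hγmul, inv_inv, mul_one, ← hγmul, two_mul]
    have h3 : HasVelocityAt 𝓘(ℝ, E) (fun s ↦ γ t * η (2 * s) * γ t) 0 (γ t * 1 * (γ (-t))⁻¹)
        (V (γ t * 1 * (γ (-t))⁻¹)) := by
      rw [h1]
      convert! h2 using 2 with s
      simp only [Prod.mk_mul_mk, mul_one, mul_inv_rev]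
      rw [map_neg_eq_inv_of_map_add hγmul, map_neg_eq_inv_of_map_add hηmul, inv_inv, inv_inv,
        two_mul, hηmul]
      simp only [mul_assoc]
    rwa [he] at h3
  -- Moving the base point `γ t * γ t` changes both outer parameters, whence `(1, 0, 1)`; the middle
  -- factor `η (2 * s)` gives `(0, 2, 0)`.
  have hVγ : HasDerivAt (fun t ↦ tangentCoord 𝓘(ℝ, E) 1 (γ (2 * t)) (V (γ (2 * t))))
      (B (1, 0, 1) (0, 2, 0)) 0 := by
    refine (hasDerivAt_fderiv_smul hF (1, 0, 1) (0, 2, 0)).congr_of_eventuallyEq ?_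
    filter_upwards [hcoord' (1, 0, 1), hVvel] with t ht hVt
    refine ht (0, 2, 0) _ _ ?_
    simpa [mul_comm] using hVt
  have h2X : HasVelocityAt 𝓘(ℝ, E) (fun t ↦ γ (2 * t)) 0 1 ((2 : ℝ) • X) := by
    refine hX.comp_real ?_ (mul_zero 2)
    simpa using (hasDerivAt_id (0 : ℝ)).const_mul 2
  have hV1 : V 1 = (2 : ℝ) • Y := by
    have h1 := hVvel.self_of_nhds
    rw [mul_zero, hγ0] at h1
    simp only [one_mul, mul_one] at h1
    refine h1.unique (hY.comp_real ?_ (mul_zero 2))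
    simpa using (hasDerivAt_id (0 : ℝ)).const_mul 2
  have hY1 := mulInvariantVectorField_one (I := 𝓘(ℝ, E)) (G := G) Y
  have hX1 := mulInvariantVectorField_one (I := 𝓘(ℝ, E)) (G := G) X
  have e1 := hYγ.unique (hΓ _ (mdifferentiableAt_mulInvariantVectorField' Y 1) X γ hX)
  have e2 := hVγ.unique (hΓ V hVd _ _ h2X)
  have e3 := hVcov ⟨_, mem_antidiagonal X⟩
  rw [dproj_antidiagonal hγmul hX, ZeroMemClass.coe_zero, map_zero] at e3
  have e4 := tangentCoord_mlieBracket (mdifferentiableAt_mulInvariantVectorField' X (1 : G))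
    (mdifferentiableAt_mulInvariantVectorField' Y 1)
  rw [hX1, hY1, ← GroupLieAlgebra.bracket_def] at e4
  have e5 := hYγ.unique (hX.hasDerivAt_comp (mdifferentiableAt_tangentCoord
    (mdifferentiableAt_mulInvariantVectorField' Y (1 : G))))
  have e6 := hXη.unique (hY.hasDerivAt_comp (mdifferentiableAt_tangentCoord
    (mdifferentiableAt_mulInvariantVectorField' X (1 : G))))
  rw [← e5, ← e6] at e4
  rw [hV1, e3] at e2
  rw [hY1] at e1
  apply (tangentCoord_bijective 𝓘(ℝ, E) (mem_chart_source E (1 : G))).1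
  simp only [map_smul, map_zero, smul_apply, zero_sub] at e2 ⊢
  rw [e4]
  have e7 : B (1, 0, 1) (0, 2, 0) =
      (2 : ℝ) • (B (1, 0, 0) (0, 1, 0) + B (0, 1, 0) (0, 0, 1)) := by
    have h1 : ((1, 0, 1) : ℝ × ℝ × ℝ) = (1, 0, 0) + (0, 0, 1) := by simp
    have h2 : ((0, 2, 0) : ℝ × ℝ × ℝ) = (2 : ℝ) • (0, 1, 0) := by simp
    rw [h1, h2, map_smul, map_add, hsymm (0, 1, 0) (0, 0, 1)]
    rfl
  rw [e7] at e2
  linear_combination (norm := module) (1 / 4 : ℝ) • e2 - e1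

/-- The canonical connection on left invariant vector fields. -/
theorem IsCanonicalConnection.cov_mulInvariantVectorField
    {cov : CovariantDerivative 𝓘(ℝ, E) E (TangentSpace 𝓘(ℝ, E) : G → Type _)}
    (h : IsCanonicalConnection 𝓘(ℝ, E) cov) (X Y : GroupLieAlgebra 𝓘(ℝ, E) G) (a : G) :
    cov (mulInvariantVectorField Y) a (mulInvariantVectorField X a) =
      mulInvariantVectorField ((1 / 2 : ℝ) • ⁅X, Y⁆) a := by
  -- `(a, 1)` acts as left translation by `a`, which preserves left invariant fields, so the formula
  -- at `1` propagates to `a`. The rest of the proof transports along `a * 1 * 1⁻¹ = a`.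
  have h1 := h.invariant (a, 1) _ (smoothField_mulInvariantVectorField Y) 1 X
  have hact : (fun x : G ↦ a * x * (1 : G)⁻¹) = fun x ↦ a * x := by simp
  have : LieGroup 𝓘(ℝ, E) (minSmoothness ℝ 3) G := lieGroup_minSmoothness
  simp only [hact] at h1
  rw [mpullback_mulInvariantVectorField, h.cov_one] at h1
  have h2 (b : G) (hb : b = a) (v : E) : (cov (mulInvariantVectorField Y) b v : E) =
      cov (mulInvariantVectorField Y) a v := by subst hb; rfl
  let D : (G → G) → E →L[ℝ] E := fun f ↦ mfderiv 𝓘(ℝ, E) 𝓘(ℝ, E) f 1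
  have hm : D (fun x : G ↦ a * x * (1 : G)⁻¹) = D fun x : G ↦ a * x := congrArg D hact
  exact (h2 (a * 1 * 1⁻¹) (by simp) _).symm.trans
    ((congrArg (cov (mulInvariantVectorField Y) (a * 1 * 1⁻¹) : E → E)
      (DFunLike.congr_fun hm X).symm).trans (h1.trans (DFunLike.congr_fun hm _)))

end Canonical

/-! ### Left translation as an isomorphism of tangent spaces -/

section Translation
variable {E : Type*} [NormedAddCommGroup E] [NormedSpace ℝ E]
  {G : Type*} [TopologicalSpace G] [ChartedSpace E G] [Group G] [LieGroup 𝓘(ℝ, E) ∞ G]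

theorem HasVelocityAt.mul {γ δ : ℝ → G} {t : ℝ} {X Y : GroupLieAlgebra 𝓘(ℝ, E) G}
    (hγ : HasVelocityAt 𝓘(ℝ, E) γ t 1 X) (hδ : HasVelocityAt 𝓘(ℝ, E) δ t 1 Y) :
    HasVelocityAt 𝓘(ℝ, E) (fun s ↦ γ s * δ s) t 1 (X + Y) := by
  have hd : MDifferentiableAt (𝓘(ℝ, E).prod 𝓘(ℝ, E)) 𝓘(ℝ, E) (fun p : G × G ↦ p.1 * p.2) (1, 1) :=
    (contMDiff_mul 𝓘(ℝ, E) ∞).mdifferentiableAt (by simp)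
  have h := (hγ.prodMk hδ).comp hd
  have h1 : HasMFDerivAt 𝓘(ℝ, E) 𝓘(ℝ, E) (fun z : G ↦ z * 1) 1 (ContinuousLinearMap.id ℝ E) :=
    (hasMFDerivAt_id (1 : G)).congr_of_eventuallyEq (.of_forall fun z ↦ mul_one z)
  have h2 : HasMFDerivAt 𝓘(ℝ, E) 𝓘(ℝ, E) (fun z : G ↦ 1 * z) 1 (ContinuousLinearMap.id ℝ E) :=
    (hasMFDerivAt_id (1 : G)).congr_of_eventuallyEq (.of_forall fun z ↦ one_mul z)
  have h3 : (mfderiv (𝓘(ℝ, E).prod 𝓘(ℝ, E)) 𝓘(ℝ, E) (fun p : G × G ↦ p.1 * p.2) (1, 1)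
      (((X : E), (Y : E)) : TangentSpace (𝓘(ℝ, E).prod 𝓘(ℝ, E)) ((1, 1) : G × G)) : E) =
      (X + Y : E) := by
    refine (mfderiv_prod_eq_add_apply hd).trans ?_
    exact congrArg₂ (fun A B : E →L[ℝ] E ↦ A X + B Y) h1.mfderiv h2.mfderiv
  have h4 := h.2
  exact ⟨h.1.trans (mul_one 1), h3 ▸ h4⟩

theorem mulInvariantVectorField_bijective (a : G) :
    Function.Bijective (fun X : GroupLieAlgebra 𝓘(ℝ, E) G ↦ mulInvariantVectorField X a) := by
  have hcomp (b c : G) (x : G) : (mfderiv 𝓘(ℝ, E) 𝓘(ℝ, E) (fun g : G ↦ b * g) (c * x) : E →L[ℝ] E).comp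
      (mfderiv 𝓘(ℝ, E) 𝓘(ℝ, E) (fun g : G ↦ c * g) x) =
      mfderiv 𝓘(ℝ, E) 𝓘(ℝ, E) (fun g : G ↦ b * c * g) x := by
    have h : (fun g : G ↦ b * c * g) = (fun g ↦ b * g) ∘ fun g ↦ c * g := by
      ext g; simp [mul_assoc]
    rw [h]
    exact (mfderiv_comp x (mdifferentiable_mul_left b (c * x)) (mdifferentiable_mul_left c x)).symm
  have hone (b x : G) (hb : b = 1) :
      (mfderiv 𝓘(ℝ, E) 𝓘(ℝ, E) (fun g : G ↦ b * g) x : E →L[ℝ] E) = ContinuousLinearMap.id ℝ E := by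
    subst hb
    exact ((hasMFDerivAt_id x).congr_of_eventuallyEq (.of_forall fun z ↦ one_mul z)).mfderiv
  refine Function.bijective_iff_has_inverse.2
    ⟨fun w ↦ (mfderiv 𝓘(ℝ, E) 𝓘(ℝ, E) (fun g : G ↦ a⁻¹ * g) (a * 1) : E →L[ℝ] E) w, ?_, ?_⟩
  · intro X
    exact DFunLike.congr_fun ((hcomp a⁻¹ a 1).trans (hone _ _ (inv_mul_cancel a))) X
  · intro w
    have h1 := (hcomp a a⁻¹ (a * 1)).trans (hone _ _ (mul_inv_cancel a))
    have h2 : a⁻¹ * (a * 1) = 1 := by simp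
    rw [h2] at h1
    exact DFunLike.congr_fun h1 w

/-- The differential of the left translation by `a` at the identity. -/
def leftTranslation (a : G) : GroupLieAlgebra 𝓘(ℝ, E) G ≃ₗ[ℝ] TangentSpace 𝓘(ℝ, E) a :=
  LinearEquiv.ofBijective (mfderiv 𝓘(ℝ, E) 𝓘(ℝ, E) (fun g : G ↦ a * g) 1 :
    GroupLieAlgebra 𝓘(ℝ, E) G →L[ℝ] TangentSpace 𝓘(ℝ, E) a).toLinearMap
    (mulInvariantVectorField_bijective a)

theorem leftTranslation_apply (a : G) (X : GroupLieAlgebra 𝓘(ℝ, E) G) :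
    leftTranslation a X = mulInvariantVectorField X a := rfl

theorem leftDistribution_eq_map (𝔭 : Submodule ℝ (GroupLieAlgebra 𝓘(ℝ, E) G)) (a : G) :
    leftDistribution 𝓘(ℝ, E) 𝔭 a = 𝔭.map (leftTranslation a).toLinearMap := rfl

end Translation

/-! ### Geometry of the coset manifold -/

section Coset
variable {E : Type*} [NormedAddCommGroup E] [NormedSpace ℝ E]
  {G : Type*} [TopologicalSpace G] [ChartedSpace E G] [Group G] {K : Subgroup G}
  {E' : Type*} [NormedAddCommGroup E'] [NormedSpace ℝ E']
  [ChartedSpace E' (G ⧸ K)]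

namespace IsCosetManifold

theorem mdifferentiable_mk (hN : IsCosetManifold 𝓘(ℝ, E) 𝓘(ℝ, E') K) :
    MDifferentiable 𝓘(ℝ, E) 𝓘(ℝ, E') (fun a : G ↦ (a : G ⧸ K)) :=
  hN.contMDiff_mk.mdifferentiable (by simp)

variable [LieGroup 𝓘(ℝ, E) ∞ G]

/-- A local section is corrected by right multiplication with the element `(s a)⁻¹ * a` of `K`,
which leaves the cosets unchanged. -/
theorem exists_section_through (hN : IsCosetManifold 𝓘(ℝ, E) 𝓘(ℝ, E') K) (a : G) :
    ∃ U : Set (G ⧸ K), IsOpen U ∧ (a : G ⧸ K) ∈ U ∧ ∃ s : G ⧸ K → G,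
      ContMDiffOn 𝓘(ℝ, E') 𝓘(ℝ, E) ∞ s U ∧ (∀ y ∈ U, (s y : G ⧸ K) = y) ∧ s a = a := by
  obtain ⟨U, hU, s, hs, hsU⟩ := hN.exists_section a
  obtain ⟨U', hU'U, hU', ha⟩ := mem_nhds_iff.1 hU
  have hk : (s a)⁻¹ * a ∈ K := QuotientGroup.eq.1 (hsU a (hU'U ha))
  refine ⟨U', hU', ha, fun y ↦ s y * ((s a)⁻¹ * a), (hs.mono hU'U).mul contMDiffOn_const,
    fun y hy ↦ ?_, by simp⟩
  rw [QuotientGroup.mk_mul_of_mem _ hk, hsU y (hU'U hy)]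

/-- Locally the translation is `y ↦ π (a * s y)` for a smooth section `s`. -/
theorem contMDiff_smul (hN : IsCosetManifold 𝓘(ℝ, E) 𝓘(ℝ, E') K) (a : G) :
    ContMDiff 𝓘(ℝ, E') 𝓘(ℝ, E') ∞ (fun x : G ⧸ K ↦ a • x) := by
  intro x
  obtain ⟨g, rfl⟩ := QuotientGroup.mk_surjective x
  obtain ⟨U, hU, hgU, s, hs, hsU, -⟩ := hN.exists_section_through g
  have h1 : ContMDiffAt 𝓘(ℝ, E') 𝓘(ℝ, E') ∞ (fun y : G ⧸ K ↦ ((a * s y : G) : G ⧸ K)) g :=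
    hN.contMDiff_mk.contMDiffAt.comp _ (contMDiffAt_const.mul (hs.contMDiffAt (hU.mem_nhds hgU)))
  refine h1.congr_of_eventuallyEq ?_
  filter_upwards [hU.mem_nhds hgU] with y hy
  conv_lhs => rw [← hsU y hy]
  rfl

theorem mdifferentiable_smul (hN : IsCosetManifold 𝓘(ℝ, E) 𝓘(ℝ, E') K) (a : G) :
    MDifferentiable 𝓘(ℝ, E') 𝓘(ℝ, E') (fun x : G ⧸ K ↦ a • x) :=
  (hN.contMDiff_smul a).mdifferentiable (by simp)

theorem mfderiv_mk_surjective (hN : IsCosetManifold 𝓘(ℝ, E) 𝓘(ℝ, E') K) (a : G) :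
    Function.Surjective (mfderiv 𝓘(ℝ, E) 𝓘(ℝ, E') (fun a : G ↦ (a : G ⧸ K)) a) := by
  obtain ⟨U, hU, haU, s, hs, hsU, hsa⟩ := hN.exists_section_through a
  have h1 : MDifferentiableAt 𝓘(ℝ, E') 𝓘(ℝ, E) s a :=
    (hs.contMDiffAt (hU.mem_nhds haU)).mdifferentiableAt (by simp)
  have h2 := (hN.mdifferentiable_mk (s a)).hasMFDerivAt.comp (a : G ⧸ K) h1.hasMFDerivAt
  have h3 : HasMFDerivAt 𝓘(ℝ, E') 𝓘(ℝ, E') ((fun a : G ↦ (a : G ⧸ K)) ∘ s) (a : G ⧸ K)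
      (ContinuousLinearMap.id ℝ E') := by
    refine (hasMFDerivAt_id (a : G ⧸ K)).congr_of_eventuallyEq ?_
    filter_upwards [hU.mem_nhds haU] with y hy using hsU y hy
  have h4 := hasMFDerivAt_unique h2 h3
  rw [hsa] at h4
  intro w
  exact ⟨(mfderiv 𝓘(ℝ, E') 𝓘(ℝ, E) s (a : G ⧸ K) : E' →L[ℝ] E) w, DFunLike.congr_fun h4 w⟩

/-- The translation by `a` of the coset manifold. -/
def smulDiffeomorph (hN : IsCosetManifold 𝓘(ℝ, E) 𝓘(ℝ, E') K) (a : G) :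
    (G ⧸ K) ≃ₘ^∞⟮𝓘(ℝ, E'), 𝓘(ℝ, E')⟯ (G ⧸ K) where
  toEquiv := MulAction.toPerm a
  contMDiff_toFun := hN.contMDiff_smul a
  contMDiff_invFun := hN.contMDiff_smul a⁻¹

theorem mfderiv_smul_bijective (hN : IsCosetManifold 𝓘(ℝ, E) 𝓘(ℝ, E') K) (a : G) (x : G ⧸ K) :
    Function.Bijective (mfderiv 𝓘(ℝ, E') 𝓘(ℝ, E') (fun x : G ⧸ K ↦ a • x) x) :=
  ((hN.smulDiffeomorph a).mfderivToContinuousLinearEquiv (by simp) x).bijective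

/-- The infinitesimal form of the equivariance `π (a * b) = a • π b`. It reduces statements about
the projection at `a` to the identity. -/
theorem mfderiv_mk_mulInvariantVectorField (hN : IsCosetManifold 𝓘(ℝ, E) 𝓘(ℝ, E') K) (a b : G)
    (X : GroupLieAlgebra 𝓘(ℝ, E) G) :
    (mfderiv 𝓘(ℝ, E) 𝓘(ℝ, E') (fun a : G ↦ (a : G ⧸ K)) (a * b)
      (mulInvariantVectorField X (a * b)) : E') =
    mfderiv 𝓘(ℝ, E') 𝓘(ℝ, E') (fun x : G ⧸ K ↦ a • x) (b : G ⧸ K)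
      (mfderiv 𝓘(ℝ, E) 𝓘(ℝ, E') (fun a : G ↦ (a : G ⧸ K)) b (mulInvariantVectorField X b)) := by
  have h1 := mfderiv_comp b (hN.mdifferentiable_mk (a * b)) (mdifferentiable_mul_left (I := 𝓘(ℝ, E)) a b)
  have h2 := mfderiv_comp b (hN.mdifferentiable_smul a (b : G ⧸ K)) (hN.mdifferentiable_mk b)
  have h3 := h1.symm.trans h2
  rw [← mfderiv_mul_left_mulInvariantVectorField]
  exact DFunLike.congr_fun h3 (mulInvariantVectorField X b)

/-- The Lie algebra of `K` is the kernel of the differential of the projection. -/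
theorem mem_subgroupLieAlgebra_iff [CompleteSpace E] [T2Space G]
    (hN : IsCosetManifold 𝓘(ℝ, E) 𝓘(ℝ, E') K) (X : GroupLieAlgebra 𝓘(ℝ, E) G) :
    X ∈ subgroupLieAlgebra 𝓘(ℝ, E) K ↔
      mfderiv 𝓘(ℝ, E) 𝓘(ℝ, E') (fun a : G ↦ (a : G ⧸ K)) 1 X = 0 := by
  constructor
  · rintro ⟨γ, hγ, hγK, hX⟩
    have h1 := HasVelocityAt.comp (I := 𝓘(ℝ, E)) (x := (1 : G)) hX (hN.mdifferentiable_mk 1)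
    have h2 : (fun t ↦ (γ t : G ⧸ K)) = fun _ ↦ ((1 : G) : G ⧸ K) := by
      funext t
      rw [QuotientGroup.eq]
      simpa using hγK t
    rw [h2] at h1
    exact h1.unique (hasVelocityAt_const _ _)
  · intro hX0
    obtain ⟨γ, hγ, hadd, hX⟩ := exists_oneParameterSubgroup X
    obtain ⟨U, hU, h1U, s, hs, hsU, hs1⟩ := hN.exists_section_through 1
    have hπγ : ContMDiff 𝓘(ℝ) 𝓘(ℝ, E') ∞ (fun t ↦ (γ t : G ⧸ K)) := hN.contMDiff_mk.comp hγ
    have hT : IsOpen ((fun t ↦ (γ t : G ⧸ K)) ⁻¹' U) := hU.preimage hπγ.continuous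
    have h0T : (0 : ℝ) ∈ (fun t ↦ (γ t : G ⧸ K)) ⁻¹' U := by
      simpa [hX.1] using h1U
    obtain ⟨ε, hε, hεT⟩ := Metric.nhds_basis_closedBall.mem_iff.1 (hT.mem_nhds h0T)
    -- `δ` lies in `K`, since `s (γ t)` and `γ t` have the same coset. It has velocity `X` because
    -- the factor `(s (γ t))⁻¹` has zero velocity when `dπ X = 0`.
    let δ : ℝ → G := fun t ↦ (s (γ t : G ⧸ K))⁻¹ * γ t
    have hδ : ContMDiffOn 𝓘(ℝ) 𝓘(ℝ, E) ∞ δ ((fun t ↦ (γ t : G ⧸ K)) ⁻¹' U) :=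
      ((hs.comp hπγ.contMDiffOn subset_rfl).inv).mul hγ.contMDiffOn
    have hδX : HasVelocityAt 𝓘(ℝ, E) δ 0 1 X := by
      have h1 := hX.comp (hN.mdifferentiable_mk 1)
      rw [hX0] at h1
      have hsd : MDifferentiableAt 𝓘(ℝ, E') 𝓘(ℝ, E) (fun y ↦ (s y)⁻¹) ((1 : G) : G ⧸ K) :=
        (hs.contMDiffAt (hU.mem_nhds h1U)).inv.mdifferentiableAt (by simp)
      have h2 := h1.comp hsd
      rw [map_zero] at h2
      have h3 : HasVelocityAt 𝓘(ℝ, E) (fun t ↦ (s (γ t : G ⧸ K))⁻¹) 0 (1 : G) 0 :=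
        ⟨h2.1.trans (by rw [hs1, inv_one]), h2.2⟩
      have h4 := h3.mul hX
      rwa [zero_add] at h4
    -- `δ` is controlled only near `0`, while the Lie algebra of `K` asks for curves on all of `ℝ`.
    -- The reparametrization `ε sin (t / ε)` stays in `[-ε, ε]` and has derivative `1` at `0`.
    have hφ (t : ℝ) : ε * Real.sin (t / ε) ∈ (fun t ↦ (γ t : G ⧸ K)) ⁻¹' U := by
      refine hεT ?_
      rw [Metric.mem_closedBall, dist_zero_right, norm_mul, Real.norm_of_nonneg hε.le]
      exact mul_le_of_le_one_right hε.le (Real.abs_sin_le_one _)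
    have hφs : ContDiff ℝ ∞ fun t : ℝ ↦ ε * Real.sin (t / ε) :=
      contDiff_const.mul (Real.contDiff_sin.comp (contDiff_id.div_const ε))
    refine ⟨fun t ↦ δ (ε * Real.sin (t / ε)), fun t ↦ ?_, fun t ↦ ?_, ?_⟩
    · exact (hδ.contMDiffAt (hT.mem_nhds (hφ t))).comp t hφs.contMDiff.contMDiffAt
    · exact QuotientGroup.eq.1 (hsU _ (hφ t))
    · have hd : HasDerivAt (fun t : ℝ ↦ ε * Real.sin (t / ε)) 1 0 := by
        have h1 := (((hasDerivAt_id (0 : ℝ)).div_const ε).sin).const_mul ε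
        simpa [hε.ne'] using h1
      have h1 := hδX.comp_real hd (by simp)
      rw [one_smul] at h1
      exact h1

theorem vertical_eq_map [CompleteSpace E] [T2Space G]
    (hN : IsCosetManifold 𝓘(ℝ, E) 𝓘(ℝ, E') K) (a : G) :
    vertical 𝓘(ℝ, E) 𝓘(ℝ, E') (fun a : G ↦ (a : G ⧸ K)) a =
      (subgroupLieAlgebra 𝓘(ℝ, E) K).map (leftTranslation a).toLinearMap := by
  have key (X : GroupLieAlgebra 𝓘(ℝ, E) G) : mfderiv 𝓘(ℝ, E) 𝓘(ℝ, E') (fun a : G ↦ (a : G ⧸ K)) a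
      (mulInvariantVectorField X a) = 0 ↔ X ∈ subgroupLieAlgebra 𝓘(ℝ, E) K := by
    rw [hN.mem_subgroupLieAlgebra_iff]
    have h1 := hN.mfderiv_mk_mulInvariantVectorField a 1 X
    rw [mulInvariantVectorField_one, mul_one] at h1
    rw [← map_eq_zero_iff _ (hN.mfderiv_smul_bijective a ((1 : G) : G ⧸ K)).1]
    exact ⟨fun h ↦ h1.symm.trans h, fun h ↦ h1.trans h⟩
  ext w
  obtain ⟨X, rfl⟩ := (leftTranslation a).surjective w
  rw [Submodule.mem_map_equiv, LinearEquiv.symm_apply_apply]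
  exact key X

theorem isCompl_leftDistribution_vertical [CompleteSpace E] [T2Space G]
    (hN : IsCosetManifold 𝓘(ℝ, E) 𝓘(ℝ, E') K) {𝔭 : Submodule ℝ (GroupLieAlgebra 𝓘(ℝ, E) G)}
    (h𝔭 : IsReductive 𝓘(ℝ, E) K 𝔭) (a : G) :
    IsCompl (leftDistribution 𝓘(ℝ, E) 𝔭 a)
      (vertical 𝓘(ℝ, E) 𝓘(ℝ, E') (fun a : G ↦ (a : G ⧸ K)) a) := by
  rw [hN.vertical_eq_map, leftDistribution_eq_map]
  exact (Submodule.orderIsoMapComap (leftTranslation a)).isCompl h𝔭.isCompl.symm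

end IsCosetManifold
end Coset

/-! ### Fields expanded in a left invariant frame -/

section LeftInvariantFrame
variable {E : Type*} [NormedAddCommGroup E] [NormedSpace ℝ E]
  {G : Type*} [TopologicalSpace G] [ChartedSpace E G] [Group G] [LieGroup 𝓘(ℝ, E) ∞ G]

theorem mdifferentiableAt_sum_mulInvariantVectorField {ι : Type*} [Fintype ι]
    (b : ι → GroupLieAlgebra 𝓘(ℝ, E) G) {ζ : G → ι → ℝ} {a : G}
    (hζ : MDifferentiableAt 𝓘(ℝ, E) 𝓘(ℝ, ι → ℝ) ζ a) :
    MDifferentiableAt 𝓘(ℝ, E) 𝓘(ℝ, E).tangent (fun g ↦ (⟨g, ∑ i, ζ g i •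
      (mulInvariantVectorField (b i) g : TangentSpace 𝓘(ℝ, E) g)⟩ : TangentBundle 𝓘(ℝ, E) G)) a := by
  refine MDifferentiableAt.sum_section fun i _ ↦ ?_
  have hi : MDifferentiableAt 𝓘(ℝ, E) 𝓘(ℝ) (fun g ↦ ζ g i) a :=
    ((ContinuousLinearMap.proj (R := ℝ) (φ := fun _ : ι ↦ ℝ) i).mdifferentiableAt).comp a hζ
  exact hi.smul_section (mdifferentiableAt_mulInvariantVectorField' (b i) a)

variable [FiniteDimensional ℝ E]

/-- The Leibniz rule combined with `∇_X Y = ½ [X, Y]`, evaluated along the curve `a * exp(tX)`. The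
`b i` need not be a basis, so the lemma applies also to the `𝔭`- and `𝔨`-parts of a basis. -/
theorem IsCanonicalConnection.cov_sum_mulInvariantVectorField [T2Space G] {ι : Type*} [Fintype ι]
    {cov : CovariantDerivative 𝓘(ℝ, E) E (TangentSpace 𝓘(ℝ, E) : G → Type _)}
    (h : IsCanonicalConnection 𝓘(ℝ, E) cov) (b : ι → GroupLieAlgebra 𝓘(ℝ, E) G)
    {ζ : G → ι → ℝ} {a : G} (hζ : MDifferentiableAt 𝓘(ℝ, E) 𝓘(ℝ, ι → ℝ) ζ a)
    {σ : Π g : G, TangentSpace 𝓘(ℝ, E) g} (hσ : ∀ g, σ g = leftTranslation g (∑ i, ζ g i • b i))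
    (X : GroupLieAlgebra 𝓘(ℝ, E) G) :
    cov σ a (leftTranslation a X) = leftTranslation a
      (∑ i, mvfderiv 𝓘(ℝ, E) ζ a (leftTranslation a X) i • b i +
        (1 / 2 : ℝ) • ⁅X, ∑ i, ζ a i • b i⁆) := by
  have : CompleteSpace E := FiniteDimensional.complete ℝ E
  have : LieGroup 𝓘(ℝ, E) (minSmoothness ℝ 3) G := lieGroup_minSmoothness
  have : IsManifold 𝓘(ℝ, E) 2 G :=
    IsManifold.of_le (n := ∞) (WithTop.coe_le_coe.2 (le_top : (2 : ℕ∞) ≤ ⊤))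
  obtain ⟨γ, -, -, hX⟩ := exists_oneParameterSubgroup X
  have hσ' : σ = fun g ↦ ∑ i, ζ g i • (mulInvariantVectorField (b i) g : TangentSpace 𝓘(ℝ, E) g) := by
    funext g
    rw [hσ, map_sum]
    simp only [map_smul]
    rfl
  have hγ := hX.mul_left a
  have hd := hasDerivAt_pi.1 (hγ.hasDerivAt_comp hζ)
  have hγ0 : a * γ 0 = a := hγ.1
  have key := cov_eq_sum_of_curve cov hγ (σ := σ)
    (V := fun i g ↦ (mulInvariantVectorField (b i) g : TangentSpace 𝓘(ℝ, E) g))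
    (hσ' ▸ mdifferentiableAt_sum_mulInvariantVectorField b hζ)
    (fun i ↦ mdifferentiableAt_mulInvariantVectorField' (b i) a) hd
    (.of_forall fun t ↦ by rw [hσ'])
  refine key.trans ?_
  have hlie : (1 / 2 : ℝ) • ⁅X, ∑ i, ζ a i • b i⁆ =
      ∑ i, ζ a i • ((1 / 2 : ℝ) • ⁅X, b i⁆ : GroupLieAlgebra 𝓘(ℝ, E) G) := by
    rw [lie_sum, Finset.smul_sum]
    exact Finset.sum_congr rfl fun i _ ↦ by rw [lie_smul, smul_comm]
  rw [hlie, ← Finset.sum_add_distrib, map_sum]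
  refine Finset.sum_congr rfl fun i _ ↦ ?_
  rw [map_add, map_smul, map_smul, h.cov_mulInvariantVectorField, hγ0]
  rfl

/-- The components of a smooth vector field in a left invariant frame are differentiable. -/
theorem mdifferentiableAt_leftTranslation_repr {ι : Type} [Fintype ι]
    (b : Module.Basis ι ℝ (GroupLieAlgebra 𝓘(ℝ, E) G)) {Y : Π g : G, TangentSpace 𝓘(ℝ, E) g}
    (hY : SmoothField 𝓘(ℝ, E) Y) (a : G) :
    MDifferentiableAt 𝓘(ℝ, E) 𝓘(ℝ, ι → ℝ)
      (fun g ↦ b.equivFun ((leftTranslation g).symm (Y g))) a := by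
  have hsum (g : G) (c : ι → ℝ) : ∑ i, c i • leftTranslation g (b i) =
      leftTranslation g (b.equivFun.symm c) := by
    simp [Module.Basis.equivFun_symm_apply]
  refine mdifferentiableAt_frame_coeff (I := 𝓘(ℝ, E)) (f := fun g : G ↦ g)
    (W := fun i g ↦ leftTranslation g (b i)) (fun g ↦ ?_)
    (fun i ↦ mdifferentiableAt_mulInvariantVectorField' (b i) a) ?_
  · simp only [hsum]
    exact (b.equivFun.symm.trans (leftTranslation g)).bijective
  · simp only [hsum, LinearEquiv.symm_apply_apply, LinearEquiv.apply_symm_apply]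
    exact ContMDiffAt.mdifferentiableAt (n := ∞) (hY a) (by simp)

end LeftInvariantFrame

/-! ### The fundamental tensor -/

section FundamentalTensor
variable {E : Type*} [NormedAddCommGroup E] [NormedSpace ℝ E]
  {G : Type*} [TopologicalSpace G] [ChartedSpace E G] [Group G] [LieGroup 𝓘(ℝ, E) ∞ G]
  {K : Subgroup G} {𝔭 : Submodule ℝ (GroupLieAlgebra 𝓘(ℝ, E) G)}

theorem IsReductive.kPart_add_pPart (h𝔭 : IsReductive 𝓘(ℝ, E) K 𝔭)
    (X : GroupLieAlgebra 𝓘(ℝ, E) G) :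
    (h𝔭.kPart X : GroupLieAlgebra 𝓘(ℝ, E) G) + h𝔭.pPart X = X :=
  Submodule.projection_add_projection_eq_self h𝔭.isCompl X

theorem IsReductive.kPart_of_mem (h𝔭 : IsReductive 𝓘(ℝ, E) K 𝔭)
    {X : GroupLieAlgebra 𝓘(ℝ, E) G} (hX : X ∈ 𝔭) : h𝔭.kPart X = 0 :=
  Submodule.projectionOnto_apply_of_mem_right h𝔭.isCompl hX

theorem IsReductive.pPart_of_mem (h𝔭 : IsReductive 𝓘(ℝ, E) K 𝔭)
    {X : GroupLieAlgebra 𝓘(ℝ, E) G} (hX : X ∈ 𝔭) :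
    (h𝔭.pPart X : GroupLieAlgebra 𝓘(ℝ, E) G) = X :=
  congrArg Subtype.val (Submodule.projectionOnto_apply_of_mem_left h𝔭.isCompl.symm hX)

theorem leftTranslation_mem_leftDistribution {a : G} {X : GroupLieAlgebra 𝓘(ℝ, E) G} :
    leftTranslation a X ∈ leftDistribution 𝓘(ℝ, E) 𝔭 a ↔ X ∈ 𝔭 := by
  rw [leftDistribution_eq_map, Submodule.mem_map_equiv, LinearEquiv.symm_apply_apply]

/-- The bilinear map `(U, V) ↦ ½ [U_𝔭, V_𝔭]_𝔨 + ½ [U_𝔭, V_𝔨]_𝔭` on the Lie algebra. -/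
def IsReductive.fundamentalForm [CompleteSpace E] (h𝔭 : IsReductive 𝓘(ℝ, E) K 𝔭) :
    GroupLieAlgebra 𝓘(ℝ, E) G →ₗ[ℝ] GroupLieAlgebra 𝓘(ℝ, E) G →ₗ[ℝ] GroupLieAlgebra 𝓘(ℝ, E) G :=
  have : LieGroup 𝓘(ℝ, E) (minSmoothness ℝ 3) G := lieGroup_minSmoothness
  LinearMap.mk₂ ℝ (fun U V ↦
    (h𝔭.kPart ((1 / 2 : ℝ) • ⁅(h𝔭.pPart U : GroupLieAlgebra 𝓘(ℝ, E) G),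
      (h𝔭.pPart V : GroupLieAlgebra 𝓘(ℝ, E) G)⁆) : GroupLieAlgebra 𝓘(ℝ, E) G) +
    (h𝔭.pPart ((1 / 2 : ℝ) • ⁅(h𝔭.pPart U : GroupLieAlgebra 𝓘(ℝ, E) G),
      (h𝔭.kPart V : GroupLieAlgebra 𝓘(ℝ, E) G)⁆) : GroupLieAlgebra 𝓘(ℝ, E) G))
    (fun U U' V ↦ by simp only [map_add, Submodule.coe_add, add_lie, smul_add]; abel)
    (fun c U V ↦ by
      simp only [map_smul, Submodule.coe_smul, smul_lie, smul_add, smul_comm c (1 / 2 : ℝ)])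
    (fun U V V' ↦ by simp only [map_add, Submodule.coe_add, lie_add, smul_add]; abel)
    (fun c U V ↦ by
      simp only [map_smul, Submodule.coe_smul, lie_smul, smul_add, smul_comm c (1 / 2 : ℝ)])

/-- The left invariant tensor field extending `IsReductive.fundamentalForm`. -/
def IsReductive.fundamentalTensor [CompleteSpace E] (h𝔭 : IsReductive 𝓘(ℝ, E) K 𝔭) (a : G) :
    TangentSpace 𝓘(ℝ, E) a →ₗ[ℝ] TangentSpace 𝓘(ℝ, E) a →ₗ[ℝ] TangentSpace 𝓘(ℝ, E) a :=
  (h𝔭.fundamentalForm.compl₁₂ (leftTranslation a).symm.toLinearMap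
    (leftTranslation a).symm.toLinearMap).compr₂ (leftTranslation a).toLinearMap

theorem IsReductive.fundamentalTensor_leftTranslation [CompleteSpace E]
    (h𝔭 : IsReductive 𝓘(ℝ, E) K 𝔭) (a : G) (U V : GroupLieAlgebra 𝓘(ℝ, E) G) :
    h𝔭.fundamentalTensor a (leftTranslation a U) (leftTranslation a V) =
      leftTranslation a (h𝔭.fundamentalForm U V) := by
  simp [fundamentalTensor]

theorem IsReductive.fundamentalForm_of_mem [CompleteSpace E] (h𝔭 : IsReductive 𝓘(ℝ, E) K 𝔭)
    {X Y : GroupLieAlgebra 𝓘(ℝ, E) G} (hX : X ∈ 𝔭) (hY : Y ∈ 𝔭) :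
    h𝔭.fundamentalForm X Y = (1 / 2 : ℝ) • (h𝔭.kPart ⁅X, Y⁆ : GroupLieAlgebra 𝓘(ℝ, E) G) := by
  have : LieGroup 𝓘(ℝ, E) (minSmoothness ℝ 3) G := lieGroup_minSmoothness
  simp only [fundamentalForm, LinearMap.mk₂_apply, h𝔭.pPart_of_mem hX, h𝔭.pPart_of_mem hY,
    h𝔭.kPart_of_mem hY, ZeroMemClass.coe_zero, lie_zero, smul_zero, map_zero, add_zero, map_smul,
    Submodule.coe_smul]

variable {E' : Type*} [NormedAddCommGroup E'] [NormedSpace ℝ E'] [ChartedSpace E' (G ⧸ K)]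
  [CompleteSpace E] [T2Space G]

theorem IsCosetManifold.leftTranslation_mem_vertical (hN : IsCosetManifold 𝓘(ℝ, E) 𝓘(ℝ, E') K)
    {a : G} {X : GroupLieAlgebra 𝓘(ℝ, E) G} :
    leftTranslation a X ∈ vertical 𝓘(ℝ, E) 𝓘(ℝ, E') (fun a : G ↦ (a : G ⧸ K)) a ↔
      X ∈ subgroupLieAlgebra 𝓘(ℝ, E) K := by
  rw [hN.vertical_eq_map, Submodule.mem_map_equiv, LinearEquiv.symm_apply_apply]

theorem IsReductive.hor_eq (h𝔭 : IsReductive 𝓘(ℝ, E) K 𝔭)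
    (hN : IsCosetManifold 𝓘(ℝ, E) 𝓘(ℝ, E') K)
    (hc : ∀ a : G, IsCompl (leftDistribution 𝓘(ℝ, E) 𝔭 a)
      (vertical 𝓘(ℝ, E) 𝓘(ℝ, E') (fun a : G ↦ (a : G ⧸ K)) a))
    {Z : Π a : G, TangentSpace 𝓘(ℝ, E) a} {a : G} {U : GroupLieAlgebra 𝓘(ℝ, E) G}
    (hU : Z a = leftTranslation a U) : hor hc Z a = leftTranslation a (h𝔭.pPart U).1 := by
  rw [hor, hU]
  conv_lhs => rw [← h𝔭.kPart_add_pPart U, map_add, map_add,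
    Submodule.projectionOnto_apply_of_mem_right (hc a)
      (hN.leftTranslation_mem_vertical.2 (h𝔭.kPart U).2), zero_add,
    Submodule.projectionOnto_apply_of_mem_left (hc a)
      (leftTranslation_mem_leftDistribution.2 (h𝔭.pPart U).2)]

theorem IsReductive.ver_eq (h𝔭 : IsReductive 𝓘(ℝ, E) K 𝔭)
    (hN : IsCosetManifold 𝓘(ℝ, E) 𝓘(ℝ, E') K)
    (hc : ∀ a : G, IsCompl (leftDistribution 𝓘(ℝ, E) 𝔭 a)
      (vertical 𝓘(ℝ, E) 𝓘(ℝ, E') (fun a : G ↦ (a : G ⧸ K)) a))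
    {Z : Π a : G, TangentSpace 𝓘(ℝ, E) a} {a : G} {U : GroupLieAlgebra 𝓘(ℝ, E) G}
    (hU : Z a = leftTranslation a U) : ver hc Z a = leftTranslation a (h𝔭.kPart U).1 := by
  rw [ver, hU]
  conv_lhs => rw [← h𝔭.kPart_add_pPart U, map_add, map_add,
    Submodule.projectionOnto_apply_of_mem_right (hc a).symm
      (leftTranslation_mem_leftDistribution.2 (h𝔭.pPart U).2), add_zero,
    Submodule.projectionOnto_apply_of_mem_left (hc a).symm
      (hN.leftTranslation_mem_vertical.2 (h𝔭.kPart U).2)]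

/-- The horizontal and vertical parts of `Y` have the same coefficient functions `ζ`, against the
`𝔭`- and `𝔨`-parts of a basis of the Lie algebra. Each derivative of `ζ` therefore remains in the
subspace that the outer projection kills, and only the bracket terms are left. -/
theorem IsReductive.isFundamentalTensor [FiniteDimensional ℝ E] (h𝔭 : IsReductive 𝓘(ℝ, E) K 𝔭)
    (hN : IsCosetManifold 𝓘(ℝ, E) 𝓘(ℝ, E') K)
    (hc : ∀ a : G, IsCompl (leftDistribution 𝓘(ℝ, E) 𝔭 a)
      (vertical 𝓘(ℝ, E) 𝓘(ℝ, E') (fun a : G ↦ (a : G ⧸ K)) a))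
    {cov : CovariantDerivative 𝓘(ℝ, E) E (TangentSpace 𝓘(ℝ, E) : G → Type _)}
    (hcov : IsCanonicalConnection 𝓘(ℝ, E) cov) :
    IsFundamentalTensor hc cov h𝔭.fundamentalTensor := by
  intro X Y hX hY a
  have : FiniteDimensional ℝ (GroupLieAlgebra 𝓘(ℝ, E) G) :=
    inferInstanceAs (FiniteDimensional ℝ E)
  let b := Module.finBasis ℝ (GroupLieAlgebra 𝓘(ℝ, E) G)
  let ζ : G → Fin (Module.finrank ℝ (GroupLieAlgebra 𝓘(ℝ, E) G)) → ℝ :=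
    fun g ↦ b.equivFun ((leftTranslation g).symm (Y g))
  have hζ : MDifferentiableAt 𝓘(ℝ, E) 𝓘(ℝ, Fin _ → ℝ) ζ a :=
    mdifferentiableAt_leftTranslation_repr b hY a
  have hsum (g : G) : ∑ i, ζ g i • b i = (leftTranslation g).symm (Y g) :=
    b.sum_equivFun _
  have hYg (g : G) : Y g = leftTranslation g ((leftTranslation g).symm (Y g)) :=
    ((leftTranslation g).apply_symm_apply _).symm
  have hhor (g : G) : hor hc Y g = leftTranslation g
      (∑ i, ζ g i • (h𝔭.pPart (b i) : GroupLieAlgebra 𝓘(ℝ, E) G)) := by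
    rw [h𝔭.hor_eq hN hc (hYg g), ← hsum]
    simp only [map_sum, map_smul, Submodule.coe_sum, Submodule.coe_smul]
  have hver (g : G) : ver hc Y g = leftTranslation g
      (∑ i, ζ g i • (h𝔭.kPart (b i) : GroupLieAlgebra 𝓘(ℝ, E) G)) := by
    rw [h𝔭.ver_eq hN hc (hYg g), ← hsum]
    simp only [map_sum, map_smul, Submodule.coe_sum, Submodule.coe_smul]
  have hXa : X a = leftTranslation a ((leftTranslation a).symm (X a)) :=
    ((leftTranslation a).apply_symm_apply _).symm
  set U := (leftTranslation a).symm (X a)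
  set V := (leftTranslation a).symm (Y a) with hV
  have hp : ∑ i, ζ a i • (h𝔭.pPart (b i) : GroupLieAlgebra 𝓘(ℝ, E) G) = h𝔭.pPart V := by
    rw [hV, ← hsum]
    simp only [map_sum, map_smul, Submodule.coe_sum, Submodule.coe_smul]
  have hk : ∑ i, ζ a i • (h𝔭.kPart (b i) : GroupLieAlgebra 𝓘(ℝ, E) G) = h𝔭.kPart V := by
    rw [hV, ← hsum]
    simp only [map_sum, map_smul, Submodule.coe_sum, Submodule.coe_smul]
  have h1 := hcov.cov_sum_mulInvariantVectorField
    (fun i ↦ (h𝔭.pPart (b i) : GroupLieAlgebra 𝓘(ℝ, E) G)) hζ hhor (h𝔭.pPart U)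
  have h2 := hcov.cov_sum_mulInvariantVectorField
    (fun i ↦ (h𝔭.kPart (b i) : GroupLieAlgebra 𝓘(ℝ, E) G)) hζ hver (h𝔭.pPart U)
  rw [← h𝔭.hor_eq hN hc hXa] at h1 h2
  rw [hp] at h1
  rw [hk] at h2
  set D : Fin (Module.finrank ℝ (GroupLieAlgebra 𝓘(ℝ, E) G)) → ℝ :=
    mvfderiv 𝓘(ℝ, E) ζ a (hor hc X a)
  rw [h𝔭.ver_eq hN hc (Z := fun g ↦ cov (hor hc Y) g (hor hc X g)) h1,
    h𝔭.hor_eq hN hc (Z := fun g ↦ cov (ver hc Y) g (hor hc X g)) h2, hXa, hYg a,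
    h𝔭.fundamentalTensor_leftTranslation, ← map_add]
  congr 1
  have e1 : ∑ i, D i • (h𝔭.pPart (b i) : GroupLieAlgebra 𝓘(ℝ, E) G) ∈ 𝔭 :=
    Submodule.sum_mem _ fun i _ ↦ Submodule.smul_mem _ _ (h𝔭.pPart (b i)).2
  have e2 : ∑ i, D i • (h𝔭.kPart (b i) : GroupLieAlgebra 𝓘(ℝ, E) G) ∈
      subgroupLieAlgebra 𝓘(ℝ, E) K :=
    Submodule.sum_mem _ fun i _ ↦ Submodule.smul_mem _ _ (h𝔭.kPart (b i)).2
  have e3 : h𝔭.pPart (∑ i, D i • (h𝔭.kPart (b i) : GroupLieAlgebra 𝓘(ℝ, E) G)) = 0 :=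
    Submodule.projectionOnto_apply_of_mem_right h𝔭.isCompl.symm e2
  rw [map_add, map_add, h𝔭.kPart_of_mem e1, e3, zero_add, zero_add]
  rfl

end FundamentalTensor

/-! ### The natural torsion-free connection of the coset manifold -/

section NaturalTorsionFree
variable {E : Type*} [NormedAddCommGroup E] [NormedSpace ℝ E] [FiniteDimensional ℝ E]
  {G : Type*} [TopologicalSpace G] [ChartedSpace E G] [Group G] [LieGroup 𝓘(ℝ, E) ∞ G]
  {K : Subgroup G} {𝔭 : Submodule ℝ (GroupLieAlgebra 𝓘(ℝ, E) G)}
  {E' : Type*} [NormedAddCommGroup E'] [NormedSpace ℝ E'] [FiniteDimensional ℝ E']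
  [ChartedSpace E' (G ⧸ K)] [IsManifold 𝓘(ℝ, E') ∞ (G ⧸ K)]

/-- The natural torsion-free connection at the base point, for a field given along a
one-parameter subgroup by its components in a left invariant frame. -/
theorem IsNaturalTorsionFree.cov_base (hN : IsCosetManifold 𝓘(ℝ, E) 𝓘(ℝ, E') K)
    {h𝔭 : IsReductive 𝓘(ℝ, E) K 𝔭}
    {cov : CovariantDerivative 𝓘(ℝ, E') E' (TangentSpace 𝓘(ℝ, E') : G ⧸ K → Type _)}
    (hcov : IsNaturalTorsionFree 𝓘(ℝ, E') h𝔭 cov) {ι : Type*} [Fintype ι] (b : ι → 𝔭) (X : 𝔭)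
    {γ : ℝ → G} (hγ : ContMDiff 𝓘(ℝ) 𝓘(ℝ, E) ∞ γ) (hadd : ∀ s t, γ (s + t) = γ s * γ t)
    (hX : HasVelocityAt 𝓘(ℝ, E) γ 0 1 (X : GroupLieAlgebra 𝓘(ℝ, E) G))
    {Z : Π x : G ⧸ K, TangentSpace 𝓘(ℝ, E') x}
    (hZ : MDifferentiableAt 𝓘(ℝ, E') 𝓘(ℝ, E').tangent
      (fun x ↦ (⟨x, Z x⟩ : TangentBundle 𝓘(ℝ, E') (G ⧸ K))) ((1 : G) : G ⧸ K))
    {c : ι → ℝ → ℝ} {c' : ι → ℝ} (hc : ∀ i, HasDerivAt (c i) (c' i) 0)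
    (hZγ : ∀ t, Z (γ t : G ⧸ K) = mfderiv 𝓘(ℝ, E) 𝓘(ℝ, E') (fun a : G ↦ (a : G ⧸ K)) (γ t)
      (leftTranslation (γ t) (∑ i, c i t • (b i : GroupLieAlgebra 𝓘(ℝ, E) G)))) :
    cov Z ((1 : G) : G ⧸ K) (mfderiv 𝓘(ℝ, E) 𝓘(ℝ, E') (fun a : G ↦ (a : G ⧸ K)) 1
        (X : GroupLieAlgebra 𝓘(ℝ, E) G)) =
      mfderiv 𝓘(ℝ, E) 𝓘(ℝ, E') (fun a : G ↦ (a : G ⧸ K)) 1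
        (∑ i, c' i • (b i : GroupLieAlgebra 𝓘(ℝ, E) G) + (1 / 2 : ℝ) •
          (h𝔭.pPart ⁅(X : GroupLieAlgebra 𝓘(ℝ, E) G), ∑ i, c i 0 • (b i : GroupLieAlgebra 𝓘(ℝ, E) G)⁆ :
            GroupLieAlgebra 𝓘(ℝ, E) G)) := by
  have : CompleteSpace E := FiniteDimensional.complete ℝ E
  have : LieGroup 𝓘(ℝ, E) (minSmoothness ℝ 3) G := lieGroup_minSmoothness
  have : IsManifold 𝓘(ℝ, E') 2 (G ⧸ K) :=
    IsManifold.of_le (n := ∞) (WithTop.coe_le_coe.2 (le_top : (2 : ℕ∞) ≤ ⊤))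
  choose V hV hVcov using fun i ↦ hcov.connection_function (b i)
  let D : (G → G ⧸ K) → G → E →L[ℝ] E' := fun f g ↦ mfderiv 𝓘(ℝ, E) 𝓘(ℝ, E') f g
  have horb : (fun g : G ↦ g • ((1 : G) : G ⧸ K)) = fun g : G ↦ (g : G ⧸ K) := by
    funext g
    exact congrArg _ (mul_one g)
  have hD : D (fun g : G ↦ g • ((1 : G) : G ⧸ K)) = D fun g : G ↦ (g : G ⧸ K) := congrArg D horb
  have hVd (i : ι) : MDifferentiableAt 𝓘(ℝ, E') 𝓘(ℝ, E').tangent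
      (fun x ↦ (⟨x, V i x⟩ : TangentBundle 𝓘(ℝ, E') (G ⧸ K))) ((1 : G) : G ⧸ K) := by
    obtain ⟨⟨U, hU, hVU⟩, -⟩ := hV i
    exact (ContMDiffOn.contMDiffAt hVU hU).mdifferentiableAt (by simp)
  -- Since `γ t = exp (tX)` with `tX ∈ 𝔭`, the defining property of the sharp field gives its values
  -- along the projected curve for small `t`. These values along the curve are all that is needed.
  have hVγ (i : ι) : ∀ᶠ t in 𝓝 (0 : ℝ), (V i (γ t : G ⧸ K) : E') =
      D (fun g : G ↦ (g : G ⧸ K)) (γ t)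
        (leftTranslation (γ t) (b i : GroupLieAlgebra 𝓘(ℝ, E) G)) := by
    have htend : Filter.Tendsto (fun t : ℝ ↦ t • (X : GroupLieAlgebra 𝓘(ℝ, E) G))
        (𝓝 0) (𝓝 0) := by
      have : Continuous (fun t : ℝ ↦ t • (X : GroupLieAlgebra 𝓘(ℝ, E) G)) :=
        continuous_id.smul continuous_const
      simpa using this.tendsto 0
    filter_upwards [htend.eventually (hV i).2] with t ht
    have h1 := ht (𝔭.smul_mem t X.2) (γ t) (isExp_smul hγ hadd hX t)
    have h2 (x y : G ⧸ K) (hxy : x = y) : (V i x : E') = V i y := by subst hxy; rfl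
    have h3 : γ t • ((1 : G) : G ⧸ K) = (γ t : G ⧸ K) := congrFun horb (γ t)
    exact (h2 _ _ h3).symm.trans (h1.trans (congrArg (fun L : G → E →L[ℝ] E' ↦
      L (γ t) (leftTranslation (γ t) (b i : GroupLieAlgebra 𝓘(ℝ, E) G))) hD))
  have hvel := hX.comp (hN.mdifferentiable_mk 1)
  have key := cov_eq_sum_of_curve cov hvel hZ hVd hc (by
    filter_upwards [Filter.eventually_all.2 hVγ] with t ht
    rw [hZγ]
    simp only [map_sum, map_smul]
    exact Finset.sum_congr rfl fun i _ ↦ congrArg (fun v : E' ↦ c i t • v) (ht i).symm)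
  have hV1 (i : ι) : (V i ((1 : G) : G ⧸ K) : E') = D (fun g : G ↦ (g : G ⧸ K)) 1 (b i).1 := by
    have h1 := (hVγ i).self_of_nhds
    have h2 : γ 0 = 1 := hX.1
    rw [h2, leftTranslation_apply, mulInvariantVectorField_one] at h1
    exact h1
  have hcov1 (i : ι) : (cov (V i) ((1 : G) : G ⧸ K) (D (fun g : G ↦ (g : G ⧸ K)) 1 X.1) : E') =
      D (fun g : G ↦ (g : G ⧸ K)) 1
        ((1 / 2 : ℝ) • h𝔭.pPart ⁅(X : GroupLieAlgebra 𝓘(ℝ, E) G), (b i : GroupLieAlgebra 𝓘(ℝ, E) G)⁆ : 𝔭).1 := by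
    have h1 := hVcov i X
    rw [← hD]
    exact h1
  refine key.trans ?_
  have hlie : (1 / 2 : ℝ) • (h𝔭.pPart ⁅(X : GroupLieAlgebra 𝓘(ℝ, E) G),
      ∑ i, c i 0 • (b i : GroupLieAlgebra 𝓘(ℝ, E) G)⁆ : GroupLieAlgebra 𝓘(ℝ, E) G) =
      ∑ i, c i 0 • ((1 / 2 : ℝ) • h𝔭.pPart ⁅(X : GroupLieAlgebra 𝓘(ℝ, E) G),
        (b i : GroupLieAlgebra 𝓘(ℝ, E) G)⁆ : 𝔭).1 := by
    rw [lie_sum, map_sum, Submodule.coe_sum, Finset.smul_sum]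
    exact Finset.sum_congr rfl fun i _ ↦ by
      rw [lie_smul, map_smul, Submodule.coe_smul, Submodule.coe_smul, smul_comm]
  rw [hlie, ← Finset.sum_add_distrib, map_sum]
  refine Finset.sum_congr rfl fun i _ ↦ ?_
  rw [map_add, map_smul, map_smul]
  exact congrArg₂ (fun v w : E' ↦ c' i • v + c i 0 • w) (hV1 i) (hcov1 i)

/-- The natural torsion-free connection in terms of the components of the horizontal lift in a
left invariant frame. -/
theorem IsNaturalTorsionFree.cov_mk [T2Space G] (hN : IsCosetManifold 𝓘(ℝ, E) 𝓘(ℝ, E') K)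
    {h𝔭 : IsReductive 𝓘(ℝ, E) K 𝔭}
    {cov : CovariantDerivative 𝓘(ℝ, E') E' (TangentSpace 𝓘(ℝ, E') : G ⧸ K → Type _)}
    (hcov : IsNaturalTorsionFree 𝓘(ℝ, E') h𝔭 cov) {ι : Type*} [Fintype ι] (b : ι → 𝔭) (X : 𝔭)
    {Z : Π x : G ⧸ K, TangentSpace 𝓘(ℝ, E') x} (hZ : SmoothField 𝓘(ℝ, E') Z)
    {ζ : G → ι → ℝ} {a : G} (hζ : MDifferentiableAt 𝓘(ℝ, E) 𝓘(ℝ, ι → ℝ) ζ a)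
    (hZζ : ∀ g : G, Z g = mfderiv 𝓘(ℝ, E) 𝓘(ℝ, E') (fun a : G ↦ (a : G ⧸ K)) g
      (leftTranslation g (∑ i, ζ g i • (b i : GroupLieAlgebra 𝓘(ℝ, E) G)))) :
    cov Z a (mfderiv 𝓘(ℝ, E) 𝓘(ℝ, E') (fun a : G ↦ (a : G ⧸ K)) a (leftTranslation a X.1)) =
      mfderiv 𝓘(ℝ, E) 𝓘(ℝ, E') (fun a : G ↦ (a : G ⧸ K)) a (leftTranslation a
        (∑ i, mvfderiv 𝓘(ℝ, E) ζ a (leftTranslation a X.1) i •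
            (b i : GroupLieAlgebra 𝓘(ℝ, E) G) +
          (1 / 2 : ℝ) • (h𝔭.pPart ⁅(X : GroupLieAlgebra 𝓘(ℝ, E) G),
            ∑ i, ζ a i • (b i : GroupLieAlgebra 𝓘(ℝ, E) G)⁆ : GroupLieAlgebra 𝓘(ℝ, E) G))) := by
  have : CompleteSpace E := FiniteDimensional.complete ℝ E
  have : CompleteSpace E' := FiniteDimensional.complete ℝ E'
  have : IsManifold 𝓘(ℝ, E') 2 (G ⧸ K) :=
    IsManifold.of_le (n := ∞) (WithTop.coe_le_coe.2 (le_top : (2 : ℕ∞) ≤ ⊤))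
  obtain ⟨γ, hγ, hadd, hX⟩ := exists_oneParameterSubgroup X.1
  have hγ0 : γ 0 = 1 := hX.1
  have hinv (x : G ⧸ K) : (mfderiv 𝓘(ℝ, E') 𝓘(ℝ, E') (fun x : G ⧸ K ↦ a • x) x).IsInvertible :=
    ⟨(hN.smulDiffeomorph a).mfderivToContinuousLinearEquiv (by simp) x, rfl⟩
  have hZd : MDifferentiableAt 𝓘(ℝ, E') 𝓘(ℝ, E').tangent
      (fun x ↦ (⟨x, mpullback 𝓘(ℝ, E') 𝓘(ℝ, E') (fun x : G ⧸ K ↦ a • x) Z x⟩ :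
        TangentBundle 𝓘(ℝ, E') (G ⧸ K))) ((1 : G) : G ⧸ K) :=
    MDifferentiableAt.mpullback_vectorField (n := ∞)
      (ContMDiffAt.mdifferentiableAt (n := ∞) (hZ _) (by simp))
      (hN.contMDiff_smul a _) (hinv _) (WithTop.coe_le_coe.2 (le_top : (2 : ℕ∞) ≤ ⊤))
  have hd := hasDerivAt_pi.1 ((hX.mul_left a).hasDerivAt_comp hζ)
  -- Pulling `Z` back by `a` replaces the coefficients along `γ` by `ζ (a * γ t)`, by equivariance
  -- of the projection on left invariant fields.
  have hbase := hcov.cov_base hN b X hγ hadd hX hZd hd (fun t ↦ by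
    rw [mpullback_apply]
    have h1 := (hZζ (a * γ t)).trans (hN.mfderiv_mk_mulInvariantVectorField a (γ t)
      (∑ i, ζ (a * γ t) i • (b i : GroupLieAlgebra 𝓘(ℝ, E) G)))
    have h2 := (hinv (γ t : G ⧸ K)).inverse_apply_eq
      (y := Z (a • (γ t : G ⧸ K))) (x := mfderiv 𝓘(ℝ, E) 𝓘(ℝ, E') (fun a : G ↦ (a : G ⧸ K)) (γ t)
        (leftTranslation (γ t) (∑ i, ζ (a * γ t) i • (b i : GroupLieAlgebra 𝓘(ℝ, E) G))))
    exact h2.2 h1)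
  -- Invariance moves the formula for the pullback at the base point to the formula for `Z` at `aK`.
  have hinvar := hcov.invariant a Z hZ ((1 : G) : G ⧸ K)
    (mfderiv 𝓘(ℝ, E) 𝓘(ℝ, E') (fun a : G ↦ (a : G ⧸ K)) 1 (X : GroupLieAlgebra 𝓘(ℝ, E) G))
  rw [hbase] at hinvar
  have hmk (Y : GroupLieAlgebra 𝓘(ℝ, E) G) :
      (mfderiv 𝓘(ℝ, E) 𝓘(ℝ, E') (fun a : G ↦ (a : G ⧸ K)) a (leftTranslation a Y) : E') =
      mfderiv 𝓘(ℝ, E') 𝓘(ℝ, E') (fun x : G ⧸ K ↦ a • x) ((1 : G) : G ⧸ K)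
        (mfderiv 𝓘(ℝ, E) 𝓘(ℝ, E') (fun a : G ↦ (a : G ⧸ K)) 1 Y) := by
    have h1 := hN.mfderiv_mk_mulInvariantVectorField a 1 Y
    rw [mulInvariantVectorField_one, mul_one] at h1
    exact h1
  have hpt (x y : G ⧸ K) (hxy : x = y) (v : E') : (cov Z x v : E') = cov Z y v := by
    subst hxy; rfl
  have h1 : a • ((1 : G) : G ⧸ K) = (a : G ⧸ K) := congrArg _ (mul_one a)
  have hγ1 : a * γ 0 = a := by rw [hγ0, mul_one]
  rw [hγ1] at hinvar
  exact ((congrArg (cov Z a : E' → E') (hmk X.1)).trans (hpt _ _ h1 _).symm).trans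
    (hinvar.trans (hmk _).symm)

end NaturalTorsionFree

/-! ### The projection is an affine submersion -/

section Projection
variable {E : Type*} [NormedAddCommGroup E] [NormedSpace ℝ E] [FiniteDimensional ℝ E]
  {G : Type*} [TopologicalSpace G] [ChartedSpace E G] [Group G] [LieGroup 𝓘(ℝ, E) ∞ G]
  {K : Subgroup G} {𝔭 : Submodule ℝ (GroupLieAlgebra 𝓘(ℝ, E) G)}

theorem isSmoothDistribution_leftDistribution :
    IsSmoothDistribution 𝓘(ℝ, E) (leftDistribution 𝓘(ℝ, E) 𝔭) := by
  intro a
  have : FiniteDimensional ℝ (GroupLieAlgebra 𝓘(ℝ, E) G) :=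
    inferInstanceAs (FiniteDimensional ℝ E)
  let b := Module.finBasis ℝ 𝔭
  refine ⟨Set.univ, Filter.univ_mem, _, fun i g ↦ leftTranslation g (b i).1, fun i ↦ ?_,
    fun g _ ↦ ⟨?_, ?_⟩⟩
  · exact ContMDiff.contMDiffOn (smoothField_mulInvariantVectorField (b i).1)
  · exact (b.linearIndependent.map' 𝔭.subtype (Submodule.ker_subtype 𝔭)).map'
      (leftTranslation g).toLinearMap (LinearEquiv.ker _)
  · have h : (Set.range fun i ↦ leftTranslation g (b i).1) =
        (leftTranslation g).toLinearMap '' (𝔭.subtype '' Set.range b) := by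
      rw [← Set.range_comp, ← Set.range_comp]
      rfl
    rw [h, Submodule.span_image, Submodule.span_image, b.span_eq, Submodule.map_subtype_top]
    rfl

variable [T2Space G]
  {E' : Type*} [NormedAddCommGroup E'] [NormedSpace ℝ E'] [ChartedSpace E' (G ⧸ K)]

/-- Injective because `𝔨 ∩ 𝔭 = 0`; surjective because `dπ` is onto and annihilates the translated
`𝔨`-part. -/
theorem IsCosetManifold.bijective_mfderiv_mk_leftTranslation
    (hN : IsCosetManifold 𝓘(ℝ, E) 𝓘(ℝ, E') K) (h𝔭 : IsReductive 𝓘(ℝ, E) K 𝔭) (a : G) :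
    Function.Bijective (fun X : 𝔭 ↦ mfderiv 𝓘(ℝ, E) 𝓘(ℝ, E') (fun a : G ↦ (a : G ⧸ K)) a
      (leftTranslation a X.1)) := by
  have : CompleteSpace E := FiniteDimensional.complete ℝ E
  constructor
  · intro X Y hXY
    have h1 : leftTranslation a (X.1 - Y.1) ∈
        vertical 𝓘(ℝ, E) 𝓘(ℝ, E') (fun a : G ↦ (a : G ⧸ K)) a := by
      rw [map_sub]
      exact (map_sub _ _ _).trans (sub_eq_zero.2 hXY)
    have h2 := Submodule.disjoint_def.1 h𝔭.isCompl.disjoint _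
      (hN.leftTranslation_mem_vertical.1 h1) (𝔭.sub_mem X.2 Y.2)
    exact Subtype.ext (sub_eq_zero.1 h2)
  · intro w
    obtain ⟨u, rfl⟩ := hN.mfderiv_mk_surjective a w
    obtain ⟨U, rfl⟩ := (leftTranslation a).surjective u
    refine ⟨h𝔭.pPart U, ?_⟩
    have h1 : mfderiv 𝓘(ℝ, E) 𝓘(ℝ, E') (fun a : G ↦ (a : G ⧸ K)) a
        (leftTranslation a (h𝔭.kPart U).1) = 0 :=
      hN.leftTranslation_mem_vertical.2 (h𝔭.kPart U).2
    conv_rhs => rw [← h𝔭.kPart_add_pPart U, map_add, map_add, h1, zero_add]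

variable [FiniteDimensional ℝ E'] [IsManifold 𝓘(ℝ, E') ∞ (G ⧸ K)]

/-- The components of the horizontal lift of a smooth vector field in a left invariant frame are
differentiable. -/
theorem IsCosetManifold.mdifferentiableAt_lift_coeff
    (hN : IsCosetManifold 𝓘(ℝ, E) 𝓘(ℝ, E') K) (h𝔭 : IsReductive 𝓘(ℝ, E) K 𝔭)
    {ι : Type} [Fintype ι] (b : Module.Basis ι ℝ 𝔭)
    {Z : Π x : G ⧸ K, TangentSpace 𝓘(ℝ, E') x} (hZ : SmoothField 𝓘(ℝ, E') Z) {ζ : G → ι → ℝ}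
    (hZζ : ∀ g : G, Z g = mfderiv 𝓘(ℝ, E) 𝓘(ℝ, E') (fun a : G ↦ (a : G ⧸ K)) g
      (leftTranslation g (∑ i, ζ g i • (b i : GroupLieAlgebra 𝓘(ℝ, E) G)))) (a : G) :
    MDifferentiableAt 𝓘(ℝ, E) 𝓘(ℝ, ι → ℝ) ζ a := by
  have hsum (g : G) (c : ι → ℝ) :
      ∑ i, c i • mfderiv 𝓘(ℝ, E) 𝓘(ℝ, E') (fun a : G ↦ (a : G ⧸ K)) g (leftTranslation g (b i).1) =
      mfderiv 𝓘(ℝ, E) 𝓘(ℝ, E') (fun a : G ↦ (a : G ⧸ K)) g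
        (leftTranslation g (∑ i, c i • (b i : GroupLieAlgebra 𝓘(ℝ, E) G))) := by
    simp only [map_sum, map_smul]
  -- The vectors `dπ(b i)` at `g` depend on `g` and not only on its coset, so they form a frame
  -- along the map `π` rather than a frame of fields on `N`.
  refine mdifferentiableAt_frame_coeff (I := 𝓘(ℝ, E')) (f := fun a : G ↦ (a : G ⧸ K))
    (W := fun i g ↦ mfderiv 𝓘(ℝ, E) 𝓘(ℝ, E') (fun a : G ↦ (a : G ⧸ K)) g
      (leftTranslation g (b i).1)) (fun g ↦ ?_) (fun i ↦ ?_) ?_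
  · have h := (hN.bijective_mfderiv_mk_leftTranslation h𝔭 g).comp b.equivFun.symm.bijective
    convert! h using 2 with c
    rw [hsum, Function.comp_apply, Module.Basis.equivFun_symm_apply, Submodule.coe_sum]
    rfl
  · have h1 : ContMDiff 𝓘(ℝ, E).tangent 𝓘(ℝ, E').tangent ∞
        (tangentMap 𝓘(ℝ, E) 𝓘(ℝ, E') (fun a : G ↦ (a : G ⧸ K))) :=
      hN.contMDiff_mk.contMDiff_tangentMap le_rfl
    exact ContMDiffAt.mdifferentiableAt (n := ∞)
      ((h1.comp (smoothField_mulInvariantVectorField (b i).1)) a) (by simp)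
  · simp only [hsum, ← hZζ]
    exact ContMDiffAt.mdifferentiableAt (n := ∞)
      ((ContMDiff.comp hZ hN.contMDiff_mk) a) (by simp)

/-- For a basis of `𝔭`, the derivatives on `G` and on `N` are given by the same coefficients `ζ`,
differing only in `[X, Y]` versus `[X, Y]_𝔭`. Taking the horizontal part removes the difference. -/
theorem IsCosetManifold.isAffineSubmersion
    (hN : IsCosetManifold 𝓘(ℝ, E) 𝓘(ℝ, E') K) (h𝔭 : IsReductive 𝓘(ℝ, E) K 𝔭)
    {covG : CovariantDerivative 𝓘(ℝ, E) E (TangentSpace 𝓘(ℝ, E) : G → Type _)}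
    (hG : IsCanonicalConnection 𝓘(ℝ, E) covG)
    {covN : CovariantDerivative 𝓘(ℝ, E') E' (TangentSpace 𝓘(ℝ, E') : G ⧸ K → Type _)}
    (hcovN : IsNaturalTorsionFree 𝓘(ℝ, E') h𝔭 covN) :
    IsAffineSubmersion 𝓘(ℝ, E) 𝓘(ℝ, E') (fun a : G ↦ (a : G ⧸ K))
      (leftDistribution 𝓘(ℝ, E) 𝔭) covG covN := by
  have : CompleteSpace E := FiniteDimensional.complete ℝ E
  have hc := hN.isCompl_leftDistribution_vertical h𝔭
  refine ⟨hN.contMDiff_mk, hN.mfderiv_mk_surjective, isSmoothDistribution_leftDistribution, hc, ?_⟩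
  intro X Z Xbar Zbar hX hZ hXbar hZbar a
  have : FiniteDimensional ℝ (GroupLieAlgebra 𝓘(ℝ, E) G) :=
    inferInstanceAs (FiniteDimensional ℝ E)
  let b := Module.finBasis ℝ 𝔭
  choose z hz𝔭 hz using fun g ↦ (hZbar g).1
  obtain ⟨x, hx𝔭, hx⟩ := (hXbar a).1
  let ζ : G → Fin (Module.finrank ℝ 𝔭) → ℝ := fun g ↦ b.equivFun ⟨z g, hz𝔭 g⟩
  have hsum (g : G) : ∑ i, ζ g i • (b i : GroupLieAlgebra 𝓘(ℝ, E) G) = z g := by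
    have h := congrArg Subtype.val (b.sum_equivFun ⟨z g, hz𝔭 g⟩)
    rw [Submodule.coe_sum] at h
    exact h
  have hZb (g : G) : Zbar g =
      leftTranslation g (∑ i, ζ g i • (b i : GroupLieAlgebra 𝓘(ℝ, E) G)) := by
    rw [hsum]
    exact (hz g).symm
  have hXb : leftTranslation a x = Xbar a := hx
  have hZζ (g : G) : Z g = mfderiv 𝓘(ℝ, E) 𝓘(ℝ, E') (fun a : G ↦ (a : G ⧸ K)) g
      (leftTranslation g (∑ i, ζ g i • (b i : GroupLieAlgebra 𝓘(ℝ, E) G))) := by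
    rw [← hZb]
    exact (hZbar g).2.symm
  have hζ := hN.mdifferentiableAt_lift_coeff h𝔭 b hZ hZζ a
  have h1 := hG.cov_sum_mulInvariantVectorField
    (fun i ↦ (b i : GroupLieAlgebra 𝓘(ℝ, E) G)) hζ hZb x
  have h2 := hcovN.cov_mk hN b ⟨x, hx𝔭⟩ hZ hζ hZζ
  rw [hXb] at h1
  have h3 := h𝔭.hor_eq hN hc (Z := fun g ↦ covG Zbar g (Xbar g)) h1
  rw [h3]
  refine ⟨leftTranslation_mem_leftDistribution.2 (h𝔭.pPart _).2, ?_⟩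
  simp only [hXb] at h2
  rw [(hXbar a).2] at h2
  refine Eq.trans ?_ h2.symm
  rw [map_add, map_smul, Submodule.coe_add, Submodule.coe_smul, h𝔭.pPart_of_mem]
  exact Submodule.sum_mem _ fun i _ ↦ Submodule.smul_mem _ _ (b i).2

end Projection

end AffineSubmersion
end

open AffineSubmersion
theorem mainTheorem7
    {E : Type*} [NormedAddCommGroup E] [NormedSpace ℝ E] [FiniteDimensional ℝ E]
    {G : Type*} [TopologicalSpace G] [T2Space G] [ConnectedSpace G] [ChartedSpace E G] [Group G]
    [LieGroup 𝓘(ℝ, E) ∞ G]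
    (K : Subgroup G) (hK : IsClosed (K : Set G))
    {E' : Type*} [NormedAddCommGroup E'] [NormedSpace ℝ E'] [FiniteDimensional ℝ E']
    [ChartedSpace E' (G ⧸ K)] [IsManifold 𝓘(ℝ, E') ∞ (G ⧸ K)]
    (hN : IsCosetManifold 𝓘(ℝ, E) 𝓘(ℝ, E') K)
    (𝔭 : Submodule ℝ (GroupLieAlgebra 𝓘(ℝ, E) G)) (h𝔭 : IsReductive 𝓘(ℝ, E) K 𝔭)
    (covG : CovariantDerivative 𝓘(ℝ, E) E (TangentSpace 𝓘(ℝ, E) : G → Type _))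
    (hG : IsCanonicalConnection 𝓘(ℝ, E) covG)
    (covN : CovariantDerivative 𝓘(ℝ, E') E' (TangentSpace 𝓘(ℝ, E') : G ⧸ K → Type _))
    (hcovN : IsNaturalTorsionFree 𝓘(ℝ, E') h𝔭 covN) :
    ∃ h : IsAffineSubmersion 𝓘(ℝ, E) 𝓘(ℝ, E') (fun a : G ↦ (a : G ⧸ K))
        (leftDistribution 𝓘(ℝ, E) 𝔭) covG covN,
      ∃ A : Π a : G, TangentSpace 𝓘(ℝ, E) a →ₗ[ℝ] TangentSpace 𝓘(ℝ, E) a →ₗ[ℝ]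
          TangentSpace 𝓘(ℝ, E) a,
        IsFundamentalTensor h.isCompl covG A ∧
        (∀ (a : G), ∀ X ∈ 𝔭, ∀ Y ∈ 𝔭,
          A a (mulInvariantVectorField X a) (mulInvariantVectorField Y a) =
            mulInvariantVectorField
              ((1 / 2 : ℝ) • (h𝔭.kPart ⁅X, Y⁆ : GroupLieAlgebra 𝓘(ℝ, E) G)) a) ∧
        ∀ (a : G), ∀ x ∈ leftDistribution 𝓘(ℝ, E) 𝔭 a, A a x x = 0 := by
  have : CompleteSpace E := FiniteDimensional.complete ℝ E
  have : LieGroup 𝓘(ℝ, E) (minSmoothness ℝ 3) G := lieGroup_minSmoothness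
  have hformula (a : G) (X : GroupLieAlgebra 𝓘(ℝ, E) G) (hX : X ∈ 𝔭)
      (Y : GroupLieAlgebra 𝓘(ℝ, E) G) (hY : Y ∈ 𝔭) :
      h𝔭.fundamentalTensor a (leftTranslation a X) (leftTranslation a Y) =
        leftTranslation a ((1 / 2 : ℝ) • (h𝔭.kPart ⁅X, Y⁆ : GroupLieAlgebra 𝓘(ℝ, E) G)) := by
    rw [h𝔭.fundamentalTensor_leftTranslation, h𝔭.fundamentalForm_of_mem hX hY]
  have h := hN.isAffineSubmersion h𝔭 hG hcovN
  refine ⟨h, h𝔭.fundamentalTensor, h𝔭.isFundamentalTensor hN h.isCompl hG, hformula, ?_⟩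
  rintro a _ ⟨X, hX, rfl⟩
  refine (hformula a X hX X hX).trans ?_
  rw [lie_self, map_zero, ZeroMemClass.coe_zero, smul_zero, map_zero]
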